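/- Let $L$ be an even positive definite lattice of rank $m=2k$ with symmetric bilinear form $\langle\cdot,\cdot\rangle$ (so $\langle x,x\rangle\in 2\mathbb Z$ for all $x\in L$; extend the form to the rational space $V=L\otimes\mathbb Q$). For a lattice $\Lambda\subset V$ let $\Lambda^*=\{x\in V:\langle x,y\rangle\in\mathbb Z\ \text{for all } y\in\Lambda\}$ be the dual lattice, and use the analogous notation for $\mathbb Z_p$-lattices in $V\otimes\mathbb Q_p$. Let $N$ be the level of $L$, i.e. the least positive integer such that $N\langle x,x\rangle\in 2\mathbb Z$ for all $x\in L^*$. Let $\mathbb H_n$ be the Siegel upper half space of complex symmetric $n\times n$ matrices with positive definite imaginary part. For a lattice $\Lambda\subset V$ and $Z\in\mathbb H_n$ put $$\theta^{(n)}_\Lambda(Z)=\sum_{(x_1,\dots,x_n)\in \Lambda^n}\exp\bigl(\pi i\,\mathrm{tr}\bigl((\langle x_i,x_j\rangle)_{i,j}\,Z\bigr)\bigr),$$ and for a function $F$ on $\mathbb H_n$ and $g=\begin{pmatrix}A&B\\ C&D\end{pmatrix}\in\mathrm{Sp}_n(\mathbb Z)$ put $$(F|_k g)(Z)=\det(CZ+D)^{-k}\,F\bigl((AZ+B)(CZ+D)^{-1}\bigr).$$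 Theorem (degree-$n$ Kitaoka formula). Let $d$ be a positive divisor of $N$ with $(d,N/d)=1$, let $c=N/d$, let $a,b$ be integers such that $M=\begin{pmatrix}a&b\\ c&d\end{pmatrix}\in\mathrm{SL}_2(\mathbb Z)$, and let $$\mathfrak M=\begin{pmatrix}a\cdot 1_n&b\cdot 1_n\\ c\cdot 1_n&d\cdot 1_n\end{pmatrix}\in\mathrm{Sp}_n(\mathbb Z).$$ Then there is a unique lattice $L'\subset V$ such that, for every prime $p$, $$L'\otimes\mathbb Z_p=\begin{cases}L\otimes\mathbb Z_p&\text{if }p\nmid d,\\ (L\otimes\mathbb Z_p)^*&\text{if }p\mid d,\end{cases}$$ and there is a constant $\kappa\in\mathbb C$ such that $$\theta^{(n)}_L|_k\mathfrak M=\kappa\cdot\theta^{(n)}_{L'}\quad\text{on }\mathbb H_n.$$ -/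

import Mathlib

open scoped TensorProduct MatrixGroups

namespace Kitaoka

noncomputable section

variable {V : Type*} [AddCommGroup V] [Module ℚ V]

/-- `L` is an even positive definite lattice in the rational quadratic space `(V, B)`:
`L` is a finitely generated subgroup spanning `V`, the symmetric form `B` is positive definite,
and `B x x` is an even integer for all `x ∈ L` (so that `B` is integral on `L`). -/
structure IsEvenPosDefLattice (B : LinearMap.BilinForm ℚ V) (L : Submodule ℤ V) : Prop where
  isLattice : Submodule.IsLattice ℚ L
  symm : ∀ x y : V, B x y = B y x
  posDef : ∀ x : V, x ≠ 0 → 0 < B x x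
  even : ∀ x ∈ L, ∃ j : ℤ, B x x = 2 * (j : ℚ)

/-- `N` is the level of `L`: the least positive integer such that `N * B x x` is an even integer
for all `x` in the dual lattice of `L`. In terms of a Gram matrix `T` of `L`, this is the least
`N ≥ 1` such that `N T⁻¹` is an integral matrix with even diagonal entries. -/
def IsLevel (B : LinearMap.BilinForm ℚ V) (L : Submodule ℤ V) (N : ℕ) : Prop :=
  IsLeast {N : ℕ | 1 ≤ N ∧
    ∀ x ∈ B.dualSubmodule L, ∃ j : ℤ, (N : ℚ) * B x x = 2 * (j : ℚ)} N

/-- The localization `L ⊗ ℤ_p`, as a `ℤ_p`-submodule of `ℚ_p ⊗ V`. -/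
def localize (p : ℕ) [Fact p.Prime] (L : Submodule ℤ V) : Submodule ℤ_[p] (ℚ_[p] ⊗[ℚ] V) :=
  Submodule.span ℤ_[p] ((fun v : V => (1 : ℚ_[p]) ⊗ₜ[ℚ] v) '' (L : Set V))

/-- `L'` is a lattice in `V` with `L' ⊗ ℤ_p = L ⊗ ℤ_p` for all primes `p ∤ d` and
`L' ⊗ ℤ_p = (L ⊗ ℤ_p)^*` for all primes `p ∣ d`, where `*` is the dual with respect to the
`ℚ_p`-bilinear extension of `B`. -/
structure IsPartialDual (B : LinearMap.BilinForm ℚ V) (L : Submodule ℤ V) (d : ℕ)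
    (L' : Submodule ℤ V) : Prop where
  isLattice : Submodule.IsLattice ℚ L'
  of_not_dvd : ∀ (p : ℕ) [Fact p.Prime], ¬ p ∣ d → localize p L' = localize p L
  of_dvd : ∀ (p : ℕ) [Fact p.Prime], p ∣ d →
    localize p L' = (LinearMap.BilinForm.baseChange ℚ_[p] B).dualSubmodule (localize p L)

/-- The Siegel upper half space of degree `n`. -/
def siegelUpperHalfSpace (n : ℕ) : Set (Matrix (Fin n) (Fin n) ℂ) :=
  {Z | Z.IsSymm ∧ (Z.map Complex.im).PosDef}

/-- The degree `n` theta series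
`θ_L^{(n)}(Z) = ∑_{(x₁, …, xₙ) ∈ Lⁿ} exp (π i tr ((B(xᵢ, xⱼ))ᵢⱼ Z))`. -/
def theta (B : LinearMap.BilinForm ℚ V) (n : ℕ) (L : Submodule ℤ V)
    (Z : Matrix (Fin n) (Fin n) ℂ) : ℂ :=
  ∑' x : Fin n → L, Complex.exp (Real.pi * Complex.I *
    Matrix.trace (Matrix.of (fun i j : Fin n => ((B (x i : V) (x j : V) : ℚ) : ℂ)) * Z))

/-- The weight `k` slash operator
`(F |_k g)(Z) = det (C Z + D)^{-k} F ((A Z + B) (C Z + D)⁻¹)` for `g = (A, B; C, D) ∈ Sp_n(ℤ)`. -/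
def slash {n : ℕ} (k : ℕ) (g : Matrix.symplecticGroup (Fin n) ℤ)
    (F : Matrix (Fin n) (Fin n) ℂ → ℂ) (Z : Matrix (Fin n) (Fin n) ℂ) : ℂ :=
  let g' : Matrix (Fin n ⊕ Fin n) (Fin n ⊕ Fin n) ℂ :=
    (g : Matrix (Fin n ⊕ Fin n) (Fin n ⊕ Fin n) ℤ).map (Int.cast : ℤ → ℂ)
  Matrix.det (g'.toBlocks₂₁ * Z + g'.toBlocks₂₂) ^ (-(k : ℤ)) *
    F ((g'.toBlocks₁₁ * Z + g'.toBlocks₁₂) * (g'.toBlocks₂₁ * Z + g'.toBlocks₂₂)⁻¹)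

/-- The diagonal embedding `(a, b; c, d) ↦ (a 1ₙ, b 1ₙ; c 1ₙ, d 1ₙ)` of `SL₂(ℤ)` into
`Sp_n(ℤ)`. -/
def diagEmbed (n : ℕ) (M : SL(2, ℤ)) : Matrix.symplecticGroup (Fin n) ℤ :=
  ⟨Matrix.fromBlocks (M 0 0 • (1 : Matrix (Fin n) (Fin n) ℤ)) (M 0 1 • 1)
      (M 1 0 • 1) (M 1 1 • 1), by
    have h := M.det_coe
    rw [Matrix.det_fin_two] at h
    rw [SymplecticGroup.mem_iff, Matrix.J, Matrix.fromBlocks_transpose,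
      Matrix.fromBlocks_multiply, Matrix.fromBlocks_multiply, Matrix.fromBlocks_inj]
    simp only [Matrix.smul_one_eq_diagonal, Matrix.diagonal_transpose, Matrix.mul_zero,
      Matrix.mul_one, Matrix.mul_neg, zero_add, add_zero, Matrix.neg_mul,
      Matrix.diagonal_mul_diagonal]
    refine ⟨?_, ?_, ?_, ?_⟩ <;> ext i j <;> by_cases hij : i = j <;>
      simp [hij, Matrix.one_apply] <;> linarith⟩

end

end Kitaoka

/-! With `c = N/d` and `A = -i(Z + d/c)` one has `cZ + d = icA` and `MZ = a/c + (i/c²)A⁻¹`. In the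
theta series at `MZ`, evenness of `L` makes the contribution of `a/c` depend only on the tuple
modulo `cL`, so the series splits into finitely many shifted Gaussian sums. Poisson summation
(`exists_tsum_tensorForm_inv`) turns each into a sum over tuples from `L*`; the rank being even, the
square roots combine to `det A ^ k`, which cancels the automorphy factor. After collecting terms
(`exists_theta_slash_eq_tsum_gaussSum`), the theta term of `(ξ₁, …, ξₙ)` carries, up to a constant,
the coefficient `∏ G(ξᵢ)` with `G(ξ) = ∑_{r ∈ L/cL} exp(πi(a B(r,r) + 2B(ξ,r) + d B(ξ,ξ))/c)`.

On `L*` the function `G` is invariant under `L`, and `G(ξ + cζ) = exp(2πi d B(ξ,ζ)) G(ξ)` for `ζ ∈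
L*`. Put `L' = {x ∈ L* : dx ∈ L}`; this is the required partial dual because `c` and `d` are coprime
and `cdL* ⊆ L`. With `ad - bc = 1`, the two rules force `G = G(0)` on `L'` (`gaussSum_of_mem`) and
`G = 0` on the rest of `L*` (`gaussSum_of_notMem`). Hence only tuples from `L'` survive, all with
the factor `G(0)ⁿ`. Uniqueness of `L'` holds because a lattice is the intersection of its
localizations with `V`. -/

namespace Kitaoka

/-! ### Poisson summation on `ℤ^ι` -/

section PoissonSummation

open MeasureTheory

variable {ι : Type*}

/-- The coordinatewise cast of an integer vector to a real vector. -/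
def intVec (n : ι → ℤ) : ι → ℝ := fun i => (n i : ℝ)

@[simp]
lemma intVec_apply (n : ι → ℤ) (i : ι) : intVec n i = n i := rfl

lemma intVec_add (m n : ι → ℤ) : intVec (m + n) = intVec m + intVec n := by
  ext i; simp

lemma intVec_injective : Function.Injective (intVec (ι := ι)) := fun m n h => by
  ext i
  exact Int.cast_injective (congrFun h i)

/-- The subgroup of integer vectors in real coordinate space. -/
def intVecSubgroup (ι : Type*) : AddSubgroup (ι → ℝ) where
  carrier := Set.range intVec
  add_mem' := by rintro _ _ ⟨a, rfl⟩ ⟨b, rfl⟩; exact ⟨a + b, by ext; simp [intVec]⟩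
  zero_mem' := ⟨0, by ext; simp [intVec]⟩
  neg_mem' := by rintro _ ⟨a, rfl⟩; exact ⟨-a, by ext; simp [intVec]⟩

/-- Integer vectors as a subgroup of real coordinate space. -/
noncomputable def intVecEquiv : (ι → ℤ) ≃ intVecSubgroup ι := Equiv.ofInjective _ intVec_injective

lemma coe_intVecEquiv (n : ι → ℤ) : (intVecEquiv n : ι → ℝ) = intVec n := rfl

variable [Fintype ι]

lemma summable_one_add_norm_intVec {p : ℕ} (hp : Fintype.card ι < p) :
    Summable fun n : ι → ℤ => ((1 + ‖intVec n‖) ^ p)⁻¹ := by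
  classical
  let b := Pi.basisFun ℝ ι
  let e := (b.restrictScalars ℤ).equivFun.symm.toEquiv
  have he (n : ι → ℤ) : ((e n : Submodule.span ℤ (Set.range b)) : ι → ℝ) = intVec n := by
    simp only [e, LinearEquiv.coe_toEquiv, Module.Basis.equivFun_symm_apply]
    ext i
    simp [b, Finset.sum_apply, Pi.single_apply, Module.Basis.restrictScalars_apply]
  have hrank : Module.finrank ℤ (Submodule.span ℤ (Set.range b)) < p := by
    rwa [Module.finrank_eq_card_basis (b.restrictScalars ℤ)]
  have h := ZLattice.summable_norm_pow_inv (Submodule.span ℤ (Set.range b)) p hrank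
  rw [← e.summable_iff] at h
  -- The comparison fails only at `n = 0`, where the bounding term is `0` by the convention `0⁻¹ =
  -- 0`.
  refine Summable.of_norm_bounded_eventually h ?_
  filter_upwards [(Set.finite_singleton (0 : ι → ℤ)).compl_mem_cofinite] with n hn
  have hn0 : 0 < ‖intVec n‖ := norm_pos_iff.mpr fun h0 => hn (intVec_injective (by
    rw [h0]; ext i; simp))
  have hen : ‖e n‖ = ‖intVec n‖ := by rw [← he n]; rfl
  simp only [Function.comp_apply, hen]
  rw [Real.norm_of_nonneg (by positivity), inv_pow]
  gcongr
  linarith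

/-- Follows from `1 + ‖y‖ ≤ (1 + R)(1 + ‖x + y‖)`; it makes polynomial decay uniform over translates
by a bounded set. -/
lemma one_add_norm_add_inv_le (p : ℕ) (x y : ι → ℝ) {R : ℝ} (hx : ‖x‖ ≤ R) :
    ((1 + ‖x + y‖) ^ p)⁻¹ ≤ (1 + R) ^ p * ((1 + ‖y‖) ^ p)⁻¹ := by
  have hR : 0 ≤ R := (norm_nonneg x).trans hx
  rw [← div_eq_mul_inv, le_div_iff₀ (by positivity), inv_mul_le_iff₀ (by positivity), ← mul_pow]
  gcongr
  have : ‖y‖ ≤ ‖x + y‖ + ‖x‖ := by simpa using norm_sub_le (x + y) x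
  nlinarith [norm_nonneg (x + y)]

/-- The half-open unit cube. -/
def unitCube (ι : Type*) : Set (ι → ℝ) := {x | ∀ i, x i ∈ Set.Ioc ((0 : ι → ℝ) i) ((0 : ι → ℝ) i + 1)}

lemma measurableSet_unitCube : MeasurableSet (unitCube ι) :=
  MeasurableSet.univ_pi' fun _ => measurableSet_Ioc

lemma isAddFundamentalDomain_unitCube :
    IsAddFundamentalDomain (intVecSubgroup ι) (unitCube ι) := by
  have : Countable (intVecSubgroup ι) := intVecEquiv.symm.injective.countable
  refine IsAddFundamentalDomain.mk' measurableSet_unitCube.nullMeasurableSet fun x => ?_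
  choose m hm hm' using fun i => existsUnique_add_zsmul_mem_Ioc (zero_lt_one' ℝ) (x i) 0
  refine ⟨intVecEquiv m, fun i => ?_, ?_⟩
  · have := hm i
    simp only [zsmul_eq_mul, mul_one] at this
    simpa [AddSubgroup.vadd_def, coe_intVecEquiv, add_comm] using this
  · intro g hg
    obtain ⟨n, rfl⟩ := intVecEquiv.surjective g
    congr 1
    ext i
    refine hm' i (n i) ?_
    have := hg i
    simpa [AddSubgroup.vadd_def, coe_intVecEquiv, add_comm] using this

lemma unitCube_norm_le {x : ι → ℝ} (hx : x ∈ unitCube ι) : ‖x‖ ≤ 1 := by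
  refine (pi_norm_le_iff_of_nonneg zero_le_one).mpr fun i => ?_
  have := hx i
  simp only [Pi.zero_apply, zero_add, Set.mem_Ioc] at this
  rw [Real.norm_of_nonneg this.1.le]
  exact this.2

lemma unitCube_volume_lt_top : volume (unitCube ι) < ⊤ :=
  (Metric.isBounded_closedBall (x := (0 : ι → ℝ)) (r := 1)).subset
    (fun x hx => by simpa using unitCube_norm_le hx) |>.measure_lt_top

lemma mFourier_coe (n : ι → ℤ) (x : ι → ℝ) :
    UnitAddTorus.mFourier n (fun i => (x i : UnitAddCircle)) =
      Complex.exp (2 * Real.pi * Complex.I * ∑ i, (n i : ℂ) * x i) := by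
  simp only [UnitAddTorus.mFourier, ContinuousMap.coe_mk, fourier_coe_apply, Finset.mul_sum,
    ← Complex.exp_sum]
  congr 1
  refine Finset.sum_congr rfl fun i _ => ?_
  push_cast
  ring

lemma mFourier_coe_add_intVec (n m : ι → ℤ) (x : ι → ℝ) :
    UnitAddTorus.mFourier n (fun i => ((intVec m + x) i : UnitAddCircle)) =
      UnitAddTorus.mFourier n (fun i => (x i : UnitAddCircle)) := by
  congr 1
  ext i
  simp

/-- **Poisson summation** on `ℤ^ι` for a continuous function of polynomial decay. -/
theorem tsum_intVec_add_eq_tsum_fourier {f : (ι → ℝ) → ℂ} (hf : Continuous f) {C : ℝ} {p : ℕ}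
    (hp : Fintype.card ι < p) (hC : ∀ x, ‖f x‖ ≤ C * ((1 + ‖x‖) ^ p)⁻¹)
    (hsum : Summable fun ξ : ι → ℤ =>
      ∫ x : ι → ℝ, Complex.exp (-(2 * Real.pi * Complex.I * ∑ i, (ξ i : ℂ) * x i)) * f x)
    (r : ι → ℝ) :
    ∑' n : ι → ℤ, f (intVec n + r) = ∑' ξ : ι → ℤ,
      (∫ x : ι → ℝ, Complex.exp (-(2 * Real.pi * Complex.I * ∑ i, (ξ i : ℂ) * x i)) * f x) *
        Complex.exp (2 * Real.pi * Complex.I * ∑ i, (ξ i : ℂ) * r i) := by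
  have hC0 : 0 ≤ C := by
    have := (norm_nonneg _).trans (hC 0)
    simpa using this
  have hbound (R : ℝ) (x : ι → ℝ) (hx : ‖x‖ ≤ R) (n : ι → ℤ) :
      ‖f (intVec n + x)‖ ≤ C * ((1 + R) ^ p * ((1 + ‖intVec n‖) ^ p)⁻¹) := by
    refine (hC _).trans (mul_le_mul_of_nonneg_left ?_ hC0)
    rw [add_comm (intVec n)]
    exact one_add_norm_add_inv_le p x _ hx
  have hgsum (R : ℝ) : Summable fun n : ι → ℤ => C * ((1 + R) ^ p * ((1 + ‖intVec n‖) ^ p)⁻¹) :=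
    ((summable_one_add_norm_intVec hp).mul_left _).mul_left _
  -- The periodization of `f`. It converges locally uniformly, hence is continuous, and it descends
  -- to the torus.
  let F : (ι → ℝ) → ℂ := fun x => ∑' n : ι → ℤ, f (intVec n + x)
  have hFcont : Continuous F := by
    rw [continuous_iff_continuousAt]
    intro x
    have : ContinuousOn F (Metric.ball 0 (‖x‖ + 1)) :=
      continuousOn_tsum (fun n => (hf.comp (continuous_const.add continuous_id)).continuousOn)
        (hgsum (‖x‖ + 1)) fun n y hy => hbound _ y (by simpa using (Metric.mem_ball.mp hy).le) n
    exact this.continuousAt (Metric.isOpen_ball.mem_nhds (by simp))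
  have hFper (m : ι → ℤ) (x : ι → ℝ) : F (intVec m + x) = F x := by
    simp only [F, ← add_assoc, ← intVec_add]
    exact (Equiv.addRight m).tsum_eq fun n => f (intVec n + x)
  let π : (ι → ℝ) → UnitAddTorus ι := fun x i => (x i : UnitAddCircle)
  have hπ : IsOpenQuotientMap π :=
    IsOpenQuotientMap.piMap fun _ => QuotientAddGroup.isOpenQuotientMap_mk
  have hlift (x y : ι → ℝ) (h : π x = π y) : F x = F y := by
    have h' (i : ι) : ∃ m : ℤ, x i = (m : ℝ) + y i := by
      have hi : ((x i : ℝ) : UnitAddCircle) = y i := congrFun h i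
      have h0 : ((x i - y i : ℝ) : UnitAddCircle) = 0 := by
        rw [AddCircle.coe_sub, hi, sub_self]
      obtain ⟨m, hm⟩ := (AddCircle.coe_eq_zero_iff (1 : ℝ)).mp h0
      refine ⟨m, ?_⟩
      rw [zsmul_eq_mul, mul_one] at hm
      linarith
    choose m hm using h'
    rw [← hFper m y]
    congr 1
    ext i
    exact hm i
  have hGπ (x : ι → ℝ) : F (Function.surjInv hπ.surjective (π x)) = F x :=
    hlift _ _ (Function.surjInv_eq hπ.surjective _)
  -- An arbitrary section of the quotient map serves here: by periodicity its choice does not affect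
  -- the value.
  let G : C(UnitAddTorus ι, ℂ) :=
    ⟨fun t => F (Function.surjInv hπ.surjective t), by
      rw [hπ.isQuotientMap.continuous_iff]
      exact hFcont.congr fun x => (hGπ x).symm⟩
  have hint : Integrable f := by
    have h1 : Integrable fun x : ι → ℝ => C * (1 + ‖x‖) ^ (-(p : ℝ)) :=
      (integrable_one_add_norm (by simpa using hp)).const_mul C
    refine h1.mono' hf.aestronglyMeasurable (Filter.Eventually.of_forall fun x => ?_)
    rw [Real.rpow_neg (by positivity), Real.rpow_natCast]
    exact hC x
  have hcoeff (ξ : ι → ℤ) : UnitAddTorus.mFourierCoeff G ξ =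
      ∫ x : ι → ℝ, Complex.exp (-(2 * Real.pi * Complex.I * ∑ i, (ξ i : ℂ) * x i)) * f x := by
    have hexp (x : ι → ℝ) : Complex.exp (-(2 * Real.pi * Complex.I * ∑ i, (ξ i : ℂ) * x i)) =
        UnitAddTorus.mFourier (-ξ) (π x) := by
      simp only [π, mFourier_coe]
      congr 1
      simp
    have : Countable (intVecSubgroup ι) := intVecEquiv.symm.injective.countable
    have hmeas : Continuous fun x : ι → ℝ => UnitAddTorus.mFourier (-ξ) (π x) :=
      (ContinuousMap.continuous _).comp hπ.continuous
    have hnorm (x : ι → ℝ) : ‖UnitAddTorus.mFourier (-ξ) (π x)‖ ≤ 1 :=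
      (ContinuousMap.norm_coe_le_norm _ _).trans_eq UnitAddTorus.mFourier_norm
    have hadd (n : ι → ℤ) (x : ι → ℝ) : UnitAddTorus.mFourier (-ξ) (π (intVec n + x)) =
        UnitAddTorus.mFourier (-ξ) (π x) := mFourier_coe_add_intVec (-ξ) n x
    simp only [hexp]
    -- Unfolding: the integral over `ℝ^ι` is cut into translates of the unit cube, on which the
    -- character is periodic. What remains is an interchange of sum and integral.
    rw [UnitAddTorus.mFourierCoeff_eq_integral G ξ 0,
      isAddFundamentalDomain_unitCube.integral_eq_tsum''
        (fun x => UnitAddTorus.mFourier (-ξ) (π x) * f x)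
        (hint.bdd_mul hmeas.aestronglyMeasurable (Filter.Eventually.of_forall hnorm)),
      ← intVecEquiv.tsum_eq]
    change ∫ x in unitCube ι, UnitAddTorus.mFourier (-ξ) (π x) •
      F (Function.surjInv hπ.surjective (π x)) = ∑' n : ι → ℤ, ∫ x in unitCube ι,
        UnitAddTorus.mFourier (-ξ) (π (intVec n + x)) * f (intVec n + x)
    simp only [hGπ, hadd, smul_eq_mul, F, ← tsum_mul_left]
    have hb (n : ι → ℤ) : ∀ᵐ x ∂volume.restrict (unitCube ι),
        ‖UnitAddTorus.mFourier (-ξ) (π x) * f (intVec n + x)‖ ≤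
          C * ((1 + 1) ^ p * ((1 + ‖intVec n‖) ^ p)⁻¹) := by
      filter_upwards [ae_restrict_mem measurableSet_unitCube] with x hx
      rw [norm_mul]
      exact (mul_le_of_le_one_left (norm_nonneg _) (hnorm x)).trans
        (hbound 1 x (unitCube_norm_le hx) n)
    have hfin : IsFiniteMeasure (volume.restrict (unitCube ι)) :=
      ⟨by simpa using unitCube_volume_lt_top⟩
    have hcont (n : ι → ℤ) : Continuous fun x =>
        UnitAddTorus.mFourier (-ξ) (π x) * f (intVec n + x) :=
      hmeas.mul (hf.comp (continuous_const.add continuous_id))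
    refine (integral_tsum_of_summable_integral_norm (fun n => ?_) ?_).symm
    · exact (integrable_const _).mono' (hcont n).aestronglyMeasurable (hb n)
    · refine Summable.of_nonneg_of_le (fun n => integral_nonneg fun _ => norm_nonneg _)
        (fun n => ?_) ((hgsum 1).mul_left (volume.real (unitCube ι)))
      refine (integral_mono_of_nonneg (Filter.Eventually.of_forall fun _ => norm_nonneg _)
        (integrable_const _) (hb n)).trans_eq ?_
      simp
  have hcoeff' : UnitAddTorus.mFourierCoeff G = fun ξ : ι → ℤ =>
      ∫ x : ι → ℝ, Complex.exp (-(2 * Real.pi * Complex.I * ∑ i, (ξ i : ℂ) * x i)) * f x :=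
    funext hcoeff
  have key := UnitAddTorus.hasSum_mFourier_series_apply_of_summable
    (f := G) (by rw [hcoeff']; exact hsum) (π r)
  have hGr : G (π r) = F r := hGπ r
  rw [hGr] at key
  change F r = _
  rw [← key.tsum_eq]
  refine tsum_congr fun ξ => ?_
  rw [hcoeff, smul_eq_mul, mFourier_coe]

end PoissonSummation

/-! ### Poisson summation for Gaussians -/

section GaussianPoisson

open MeasureTheory Matrix

/-- Combines `X ^ p / p! ≤ exp X` at `X = δ(1 + t²)` with `1 + t ≤ 2(1 + t²)`. -/
lemma exp_neg_mul_sq_le {δ : ℝ} (hδ : 0 < δ) (p : ℕ) {t : ℝ} (ht : 0 ≤ t) :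
    Real.exp (-(δ * t ^ 2)) ≤
      2 ^ p * (δ ^ p)⁻¹ * p.factorial * Real.exp δ * ((1 + t) ^ p)⁻¹ := by
  have h1 := Real.pow_div_factorial_le_exp (δ * (1 + t ^ 2)) (by positivity) p
  rw [div_le_iff₀ (by positivity), mul_pow] at h1
  have h2 : (1 + t) ^ p ≤ 2 ^ p * (1 + t ^ 2) ^ p := by
    rw [← mul_pow]
    gcongr
    nlinarith [sq_nonneg (t - 1), sq_nonneg t]
  have h3 : Real.exp (δ * (1 + t ^ 2)) = Real.exp δ * Real.exp (δ * t ^ 2) := by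
    rw [← Real.exp_add]; ring_nf
  rw [← div_eq_mul_inv, le_div_iff₀ (by positivity), Real.exp_neg, inv_mul_le_iff₀ (Real.exp_pos _)]
  calc (1 + t) ^ p ≤ 2 ^ p * (δ ^ p)⁻¹ * (δ ^ p * (1 + t ^ 2) ^ p) := by
        rw [mul_assoc, inv_mul_cancel_left₀ (by positivity)]; exact h2
    _ ≤ 2 ^ p * (δ ^ p)⁻¹ * (Real.exp (δ * (1 + t ^ 2)) * p.factorial) := by gcongr
    _ = _ := by rw [h3]; ring

variable {ι : Type*} [Fintype ι]

/-- The Gaussian with exponents `w` in the coordinates given by the rows of `P`. -/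
noncomputable def gaussian (P : Matrix ι ι ℝ) (w : ι → ℂ) (x : ι → ℝ) : ℂ :=
  Complex.exp (-Real.pi * ∑ i, w i * ((P *ᵥ x) i : ℂ) ^ 2)

lemma continuous_gaussian (P : Matrix ι ι ℝ) (w : ι → ℂ) : Continuous (gaussian P w) := by
  unfold gaussian Matrix.mulVec dotProduct
  fun_prop

variable [DecidableEq ι]

lemma exists_norm_gaussian_le {P : Matrix ι ι ℝ} (hP : P.det ≠ 0) {w : ι → ℂ}
    (hw : ∀ i, 0 < (w i).re) (p : ℕ) :
    ∃ C : ℝ, ∀ x, ‖gaussian P w x‖ ≤ C * ((1 + ‖x‖) ^ p)⁻¹ := by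
  obtain ⟨ε, hε, hεw⟩ : ∃ ε > 0, ∀ i, ε ≤ (w i).re := by
    cases isEmpty_or_nonempty ι
    · exact ⟨1, one_pos, fun i => isEmptyElim i⟩
    · obtain ⟨i, hi⟩ := Finite.exists_min fun i => (w i).re
      exact ⟨_, hw i, hi⟩
  let T := (P⁻¹).mulVecLin.toContinuousLinearMap
  have hT (x : ι → ℝ) : ‖x‖ ≤ (‖T‖ + 1) * ‖P *ᵥ x‖ := by
    have h1 : T (P *ᵥ x) = x := by
      simp [T, Matrix.mulVec_mulVec, Matrix.nonsing_inv_mul _ (isUnit_iff_ne_zero.mpr hP)]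
    calc ‖x‖ = ‖T (P *ᵥ x)‖ := by rw [h1]
      _ ≤ ‖T‖ * ‖P *ᵥ x‖ := T.le_opNorm _
      _ ≤ _ := by gcongr; linarith
  -- Chosen so that `‖gaussian P w x‖ ≤ exp(-δ‖x‖²)`; the `+ 1` keeps the denominator positive.
  let δ : ℝ := Real.pi * ε / (‖T‖ + 1) ^ 2
  have hδ : 0 < δ := by positivity
  refine ⟨2 ^ p * (δ ^ p)⁻¹ * p.factorial * Real.exp δ, fun x => ?_⟩
  refine le_trans ?_ (exp_neg_mul_sq_le hδ p (norm_nonneg x))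
  rw [gaussian, Complex.norm_exp]
  refine Real.exp_le_exp.mpr ?_
  have hre : (-Real.pi * ∑ i, w i * ((P *ᵥ x) i : ℂ) ^ 2 : ℂ).re =
      -(Real.pi * ∑ i, (w i).re * ((P *ᵥ x) i) ^ 2) := by
    rw [← Complex.ofReal_neg, Complex.re_ofReal_mul, Complex.re_sum, neg_mul]
    congr 3
    ext i
    rw [← Complex.ofReal_pow, Complex.re_mul_ofReal]
  rw [hre, neg_le_neg_iff]
  have h2 : ‖P *ᵥ x‖ ^ 2 ≤ ∑ i, ((P *ᵥ x) i) ^ 2 := by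
    have h0 : 0 ≤ ∑ i, ((P *ᵥ x) i) ^ 2 := Finset.sum_nonneg fun _ _ => sq_nonneg _
    rw [← Real.sq_sqrt h0]
    gcongr
    refine (pi_norm_le_iff_of_nonneg (Real.sqrt_nonneg _)).mpr fun i => ?_
    refine Real.le_sqrt_of_sq_le ?_
    rw [Real.norm_eq_abs, sq_abs]
    exact Finset.single_le_sum (f := fun i => ((P *ᵥ x) i) ^ 2) (fun _ _ => sq_nonneg _)
      (Finset.mem_univ i)
  have h3 : ε * ‖P *ᵥ x‖ ^ 2 ≤ ∑ i, (w i).re * ((P *ᵥ x) i) ^ 2 := by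
    refine (mul_le_mul_of_nonneg_left h2 hε.le).trans ?_
    rw [Finset.mul_sum]
    exact Finset.sum_le_sum fun i _ => mul_le_mul_of_nonneg_right (hεw i) (sq_nonneg _)
  calc δ * ‖x‖ ^ 2 ≤ δ * ((‖T‖ + 1) * ‖P *ᵥ x‖) ^ 2 := by gcongr; exact hT x
    _ = Real.pi * (ε * ‖P *ᵥ x‖ ^ 2) := by simp only [δ]; field_simp
    _ ≤ _ := by gcongr

lemma summable_gaussian_intVec_add {P : Matrix ι ι ℝ} (hP : P.det ≠ 0) {w : ι → ℂ}
    (hw : ∀ i, 0 < (w i).re) (r : ι → ℝ) :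
    Summable fun n : ι → ℤ => gaussian P w (intVec n + r) := by
  obtain ⟨C, hC⟩ := exists_norm_gaussian_le hP hw (Fintype.card ι + 1)
  have hC0 : 0 ≤ C := by simpa using (norm_nonneg _).trans (hC 0)
  refine Summable.of_norm_bounded
    (((summable_one_add_norm_intVec (ι := ι) (Nat.lt_succ_self _)).mul_left
      ((1 + ‖r‖) ^ (Fintype.card ι + 1))).mul_left C) fun n => (hC _).trans ?_
  rw [add_comm (intVec n)]
  exact mul_le_mul_of_nonneg_left (one_add_norm_add_inv_le _ r _ le_rfl) hC0

lemma integral_comp_mulVec {P : Matrix ι ι ℝ} (hP : P.det ≠ 0) {g : (ι → ℝ) → ℂ}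
    (hg : Continuous g) :
    ∫ x, g (P *ᵥ x) = (|P.det|⁻¹ : ℝ) • ∫ y, g y := by
  have hcont : Continuous (Matrix.toLin' P) := LinearMap.continuous_of_finiteDimensional _
  have h := integral_map (μ := volume) hcont.aemeasurable
    (f := g) hg.aestronglyMeasurable
  rw [Real.map_matrix_volume_pi_eq_smul_volume_pi hP, integral_smul_measure,
    ENNReal.toReal_ofReal (abs_nonneg _), abs_inv] at h
  rw [h]
  rfl

/-- The Fourier transform of a Gaussian. -/
lemma fourier_gaussian {P : Matrix ι ι ℝ} (hP : P.det ≠ 0) {w : ι → ℂ}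
    (hw : ∀ i, 0 < (w i).re) (ξ : ι → ℝ) :
    ∫ x : ι → ℝ, Complex.exp (-(2 * Real.pi * Complex.I * ∑ i, (ξ i : ℂ) * x i)) *
        gaussian P w x =
      ((|P.det|⁻¹ : ℝ) * ∏ i, (1 / w i) ^ (1 / 2 : ℂ)) *
        gaussian (P⁻¹)ᵀ (fun i => (w i)⁻¹) ξ := by
  have hw0 (i : ι) : w i ≠ 0 := fun h => by simpa [h] using hw i
  have hπ : (Real.pi : ℂ) ≠ 0 := by exact_mod_cast Real.pi_ne_zero
  -- The dual variable: `ξ ⬝ x = η ⬝ Px`, so the substitution `y = Px` gives a product of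
  -- one-dimensional Gaussian integrals.
  let η : ι → ℝ := (P⁻¹)ᵀ *ᵥ ξ
  let g : (ι → ℝ) → ℂ := fun y => Complex.exp (-∑ i, (Real.pi * w i) * (y i : ℂ) ^ 2 +
    ∑ i, (-(2 * Real.pi * Complex.I) * η i) * y i)
  have hg : Continuous g := by fun_prop
  have hη (x : ι → ℝ) : ∑ i, (ξ i : ℂ) * x i = ∑ i, (η i : ℂ) * ((P *ᵥ x) i : ℝ) := by
    have : ξ ⬝ᵥ x = η ⬝ᵥ (P *ᵥ x) := by
      simp only [η]
      rw [Matrix.mulVec_transpose, ← Matrix.dotProduct_mulVec, Matrix.mulVec_mulVec,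
        Matrix.nonsing_inv_mul _ (isUnit_iff_ne_zero.mpr hP), Matrix.one_mulVec]
    have h2 := congrArg (fun t : ℝ => (t : ℂ)) this
    simpa [dotProduct] using h2
  have hint : (fun x : ι → ℝ => Complex.exp (-(2 * Real.pi * Complex.I * ∑ i, (ξ i : ℂ) * x i)) *
        gaussian P w x) = fun x => g (P *ᵥ x) := by
    ext x
    simp only [gaussian, g, ← Complex.exp_add, hη x]
    congr 1
    simp only [Finset.mul_sum, ← Finset.sum_neg_distrib, ← Finset.sum_add_distrib]
    refine Finset.sum_congr rfl fun i _ => by ring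
  rw [hint, integral_comp_mulVec hP hg, GaussianFourier.integral_cexp_neg_sum_mul_add
    (fun i => by rw [Complex.re_ofReal_mul]; exact mul_pos Real.pi_pos (hw i)),
    Finset.prod_mul_distrib, ← Complex.exp_sum, Complex.real_smul, ← mul_assoc]
  congr 1
  · congr 1
    refine Finset.prod_congr rfl fun i _ => ?_
    congr 1
    field_simp
  · rw [gaussian, Finset.mul_sum]
    congr 1
    refine Finset.sum_congr rfl fun i _ => ?_
    change _ = -Real.pi * ((w i)⁻¹ * (η i : ℂ) ^ 2)
    have := hw0 i
    field_simp
    rw [Complex.I_sq]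
    ring

/-- The **transformation formula for Gaussian sums** over `ℤ^ι`. -/
theorem tsum_gaussian_intVec_add {P : Matrix ι ι ℝ} (hP : P.det ≠ 0) {w : ι → ℂ}
    (hw : ∀ i, 0 < (w i).re) (r : ι → ℝ) :
    ∑' n : ι → ℤ, gaussian P w (intVec n + r) =
      ((|P.det|⁻¹ : ℝ) * ∏ i, (1 / w i) ^ (1 / 2 : ℂ)) * ∑' ξ : ι → ℤ,
        gaussian (P⁻¹)ᵀ (fun i => (w i)⁻¹) (intVec ξ) *
          Complex.exp (2 * Real.pi * Complex.I * ∑ i, (ξ i : ℂ) * r i) := by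
  obtain ⟨C, hC⟩ := exists_norm_gaussian_le hP hw (Fintype.card ι + 1)
  have hfour (ξ : ι → ℤ) := fourier_gaussian hP hw (intVec ξ)
  simp only [intVec_apply, Complex.ofReal_intCast] at hfour
  have hw' (i : ι) : 0 < ((w i)⁻¹).re := by
    rw [Complex.inv_re]
    exact div_pos (hw i) (Complex.normSq_pos.mpr fun h => by simpa [h] using hw i)
  have hP' : ((P⁻¹)ᵀ).det ≠ 0 := by
    rw [Matrix.det_transpose, Matrix.det_nonsing_inv, Ring.inverse_eq_inv']
    exact inv_ne_zero hP
  have hsum := summable_gaussian_intVec_add hP' hw' 0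
  simp only [add_zero] at hsum
  rw [tsum_intVec_add_eq_tsum_fourier (continuous_gaussian P w) (Nat.lt_succ_self _) hC
    (by simp only [hfour]; exact hsum.mul_left _), ← tsum_mul_left]
  refine tsum_congr fun ξ => ?_
  rw [hfour, mul_assoc]

end GaussianPoisson

/-! ### Inversion formula for the forms `S ⊗ A⁻¹` -/

section SiegelGaussian

open Matrix Kronecker

variable {n ι : Type*} [Fintype n] [Fintype ι]

/-- The value `∑ᵢⱼ Uᵢⱼ xᵢᵀ S xⱼ` of the form `U ⊗ S` at the tuple of vectors `x`. -/
noncomputable def tensorForm (S : Matrix ι ι ℝ) (U : Matrix n n ℂ) (x : n × ι → ℝ) : ℂ :=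
  ∑ i, ∑ j, U i j * ((∑ s, ∑ t, S s t * x (i, s) * x (j, t) : ℝ) : ℂ)

variable [DecidableEq n] [DecidableEq ι]

lemma transpose_mul_diagonal_mul_apply {α : Type*} [CommRing α] (P : Matrix n n α) (w : n → α)
    (i j : n) : (Pᵀ * diagonal w * P) i j = ∑ l, P l i * w l * P l j := by
  rw [mul_apply]
  simp only [mul_diagonal, transpose_apply]

open scoped MatrixOrder in
lemma posSemidef_iff_eq_conjTranspose_mul_self {S : Matrix ι ι ℝ} :
    S.PosSemidef ↔ ∃ R : Matrix ι ι ℝ, S = Rᴴ * R := by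
  rw [← nonneg_iff_posSemidef]
  exact CStarAlgebra.nonneg_iff_eq_star_mul_self

/-- A positive definite real matrix is `RᵀR` with `R` invertible. -/
lemma exists_transpose_mul_self {S : Matrix ι ι ℝ} (hS : S.PosDef) :
    ∃ R : Matrix ι ι ℝ, R.det ≠ 0 ∧ S = Rᵀ * R := by
  obtain ⟨R, hR⟩ := posSemidef_iff_eq_conjTranspose_mul_self.mp hS.posSemidef
  rw [conjTranspose_eq_transpose_of_trivial] at hR
  refine ⟨R, fun h => hS.det_pos.ne' ?_, hR⟩
  rw [hR, det_mul, h, mul_zero]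

/-- A complex symmetric matrix with positive definite real part is diagonalized by a real
congruence. -/
lemma exists_real_congr_diagonal {A : Matrix n n ℂ} (hA : A.IsSymm)
    (hpos : (A.map Complex.re).PosDef) :
    ∃ (P : Matrix n n ℝ) (w : n → ℂ), P.det ≠ 0 ∧ (∀ i, 0 < (w i).re) ∧
      A = (P.map Complex.ofReal)ᵀ * diagonal w * P.map Complex.ofReal := by
  -- Simultaneous diagonalization: with `Re A = TᵀT`, congruence by `T⁻¹` makes the real part `1`,
  -- and an orthogonal `O` then diagonalizes the imaginary part. So `P = OᵀT` and `w = 1 + iD`.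
  obtain ⟨T, hT, hTA⟩ := exists_transpose_mul_self hpos
  have hTu : IsUnit T.det := isUnit_iff_ne_zero.mpr hT
  have hH : ((T⁻¹)ᵀ * A.map Complex.im * T⁻¹).IsHermitian := by
    have hAim : (A.map Complex.im)ᵀ = A.map Complex.im := by
      rw [← Matrix.transpose_map, hA]
    rw [IsHermitian, conjTranspose_eq_transpose_of_trivial]
    simp only [transpose_mul, transpose_transpose, hAim, mul_assoc]
  let O : Matrix n n ℝ := hH.eigenvectorUnitary
  have hOO : O * Oᵀ = 1 := Unitary.coe_mul_star_self hH.eigenvectorUnitary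
  have hspec : (T⁻¹)ᵀ * A.map Complex.im * T⁻¹ = O * diagonal hH.eigenvalues * Oᵀ := by
    have h := hH.spectral_theorem
    rw [Unitary.conjStarAlgAut_apply] at h
    exact h
  clear_value O
  generalize hH.eigenvalues = D at hspec
  have him : A.map Complex.im = (Oᵀ * T)ᵀ * diagonal D * (Oᵀ * T) := by
    have h1 : A.map Complex.im = Tᵀ * ((T⁻¹)ᵀ * A.map Complex.im * T⁻¹) * T := by
      rw [transpose_nonsing_inv, mul_assoc, mul_assoc, nonsing_inv_mul _ hTu,
        mul_one, mul_nonsing_inv_cancel_left _ _ (by rwa [det_transpose])]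
    refine h1.trans ?_
    rw [hspec]
    simp only [transpose_mul, transpose_transpose, mul_assoc]
  have hre : A.map Complex.re = (Oᵀ * T)ᵀ * (Oᵀ * T) := by
    rw [hTA, transpose_mul, transpose_transpose, mul_assoc, ← mul_assoc O, hOO, one_mul]
  refine ⟨Oᵀ * T, fun i => 1 + D i * Complex.I, ?_, fun i => by simp, ?_⟩
  · rw [det_mul]
    refine mul_ne_zero (fun h0 => ?_) hT
    have := congrArg det hOO
    rw [det_mul, h0, mul_zero, det_one] at this
    exact zero_ne_one this
  · generalize Oᵀ * T = P at him hre
    ext i j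
    have h1 := congrFun (congrFun hre i) j
    have h2 := congrFun (congrFun him i) j
    rw [transpose_mul_diagonal_mul_apply] at h2 ⊢
    simp only [map_apply, mul_apply, transpose_apply] at h1 h2 ⊢
    rw [← Complex.re_add_im (A i j), h1, h2]
    push_cast
    rw [Finset.sum_mul, ← Finset.sum_add_distrib]
    exact Finset.sum_congr rfl fun l _ => by ring

-- Passes between the coordinate-free form and the diagonal Gaussian to which Poisson summation
-- applies. The weights depend only on the `n`-component, so each is repeated `card ι` times.
omit [DecidableEq ι] in
lemma gaussian_kronecker (R : Matrix ι ι ℝ) (P : Matrix n n ℝ) (w : n → ℂ) (x : n × ι → ℝ) :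
    gaussian (P ⊗ₖ R) (fun q => w q.1) x = Complex.exp (-Real.pi * tensorForm (Rᵀ * R)
      ((P.map Complex.ofReal)ᵀ * diagonal w * P.map Complex.ofReal) x) := by
  let y : n → ι → ℝ := fun i u => ∑ s, R u s * x (i, s)
  have h1 (l : n) (u : ι) : ((P ⊗ₖ R) *ᵥ x) (l, u) = ∑ i, P l i * y i u := by
    simp only [mulVec, dotProduct, Fintype.sum_prod_type, kronecker_apply, y, Finset.mul_sum,
      mul_assoc]
  have h2 (i j : n) : ∑ s, ∑ t, (Rᵀ * R) s t * x (i, s) * x (j, t) = ∑ u, y i u * y j u := by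
    simp only [mul_apply, transpose_apply, y, Finset.sum_mul_sum]
    simp only [Finset.sum_mul]
    rw [Finset.sum_comm_cycle]
    refine Finset.sum_congr rfl fun u _ => Finset.sum_congr rfl fun s _ =>
      Finset.sum_congr rfl fun t _ => by ring
  rw [gaussian, tensorForm]
  congr 2
  simp only [transpose_mul_diagonal_mul_apply, h2, map_apply, Finset.sum_mul]
  rw [← Fintype.sum_prod_type' (f := fun i j => ∑ l, (P l i : ℂ) * w l * P l j *
    ((∑ u, y i u * y j u : ℝ) : ℂ))]
  have h3 (q : n × ι) : w q.1 * (((P ⊗ₖ R) *ᵥ x) q : ℂ) ^ 2 = ∑ p : n × n,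
      (P q.1 p.1 : ℂ) * w q.1 * P q.1 p.2 * (y p.1 q.2 * y p.2 q.2) := by
    rw [show q = (q.1, q.2) from rfl, h1, Fintype.sum_prod_type]
    push_cast
    rw [sq, Finset.sum_mul_sum]
    simp only [Finset.mul_sum]
    refine Finset.sum_congr rfl fun i _ => Finset.sum_congr rfl fun j _ => by ring
  simp only [h3]
  rw [Finset.sum_comm]
  refine Finset.sum_congr rfl fun p _ => ?_
  push_cast
  rw [Fintype.sum_prod_type]
  simp only [Finset.mul_sum]

/-- The inversion formula for theta sums attached to `S ⊗ A⁻¹`, with `S` of even size. -/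
theorem exists_tsum_tensorForm_inv {k : ℕ} (hk : Fintype.card ι = 2 * k) {S : Matrix ι ι ℝ}
    (hS : S.PosDef) :
    ∃ C : ℂ, ∀ A : Matrix n n ℂ, A.IsSymm → (A.map Complex.re).PosDef → A.det ≠ 0 ∧
      (∀ r : n × ι → ℝ, Summable fun x : n × ι → ℤ =>
        Complex.exp (-Real.pi * tensorForm S A⁻¹ (intVec x + r))) ∧
      (Summable fun ξ : n × ι → ℤ =>
        Complex.exp (-Real.pi * tensorForm S⁻¹ A (intVec ξ))) ∧
      ∀ r : n × ι → ℝ,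
      ∑' x : n × ι → ℤ, Complex.exp (-Real.pi * tensorForm S A⁻¹ (intVec x + r)) =
        C * A.det ^ k * ∑' ξ : n × ι → ℤ, Complex.exp (-Real.pi * tensorForm S⁻¹ A (intVec ξ)) *
          Complex.exp (2 * Real.pi * Complex.I * ∑ q, (ξ q : ℂ) * r q) := by
  obtain ⟨R, hR, rfl⟩ := exists_transpose_mul_self hS
  -- This is `det S ^ (-n/2)`, independent of `A`.
  refine ⟨((|R.det| ^ Fintype.card n)⁻¹ : ℝ), fun A hA hpos => ?_⟩
  obtain ⟨P, w, hP, hw, rfl⟩ := exists_real_congr_diagonal hA hpos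
  have hw0 (i : n) : w i ≠ 0 := fun h => by simpa [h] using hw i
  have hPc : (P.map Complex.ofReal).det = P.det := (RingHom.map_det Complex.ofRealHom P).symm
  have hPinv : (P.map Complex.ofReal)⁻¹ = P⁻¹.map Complex.ofReal := by
    refine inv_eq_right_inv ?_
    have h := congrArg (fun Q : Matrix n n ℝ => Q.map Complex.ofRealHom)
      (mul_nonsing_inv P (isUnit_iff_ne_zero.mpr hP))
    rw [Matrix.map_mul, Matrix.map_one _ (map_zero _) (map_one _)] at h
    exact h
  have hinv : ((P.map Complex.ofReal)ᵀ * diagonal w * P.map Complex.ofReal)⁻¹ =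
      (((P⁻¹)ᵀ).map Complex.ofReal)ᵀ * diagonal (fun i => (w i)⁻¹) *
        ((P⁻¹)ᵀ).map Complex.ofReal := by
    have hd : (diagonal w)⁻¹ = diagonal fun i => (w i)⁻¹ := by
      refine inv_eq_right_inv ?_
      rw [diagonal_mul_diagonal, ← diagonal_one]
      congr 1
      ext i
      exact mul_inv_cancel₀ (hw0 i)
    rw [Matrix.mul_inv_rev, Matrix.mul_inv_rev, hd, ← transpose_nonsing_inv, hPinv, ← mul_assoc]
    rfl
  have hdet : ((P.map Complex.ofReal)ᵀ * diagonal w * P.map Complex.ofReal).det =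
      (P.det : ℂ) ^ 2 * ∏ i, w i := by
    rw [det_mul, det_mul, det_transpose, det_diagonal, hPc]
    ring
  have hdet0 : (P.det : ℂ) ^ 2 * ∏ i, w i ≠ 0 :=
    mul_ne_zero (pow_ne_zero _ (by exact_mod_cast hP)) (Finset.prod_ne_zero_iff.mpr fun i _ => hw0 i)
  have hP' : ((P⁻¹)ᵀ).det = P.det⁻¹ := by
    rw [det_transpose, det_nonsing_inv, Ring.inverse_eq_inv']
  have hR' : ((R⁻¹)ᵀ).det = R.det⁻¹ := by
    rw [det_transpose, det_nonsing_inv, Ring.inverse_eq_inv']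
  have hQ : ((P⁻¹)ᵀ ⊗ₖ R).det ≠ 0 := by
    rw [det_kronecker, hP']
    exact mul_ne_zero (pow_ne_zero _ (inv_ne_zero hP)) (pow_ne_zero _ hR)
  have hQ' : (P ⊗ₖ (R⁻¹)ᵀ).det ≠ 0 := by
    rw [det_kronecker, hR']
    exact mul_ne_zero (pow_ne_zero _ hP) (pow_ne_zero _ (inv_ne_zero hR))
  have hw' (q : n × ι) : 0 < ((w q.1)⁻¹).re := by
    rw [Complex.inv_re]
    exact div_pos (hw q.1) (Complex.normSq_pos.mpr (hw0 q.1))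
  have hQinv : (((P⁻¹)ᵀ ⊗ₖ R)⁻¹)ᵀ = P ⊗ₖ (R⁻¹)ᵀ := by
    rw [inv_kronecker, ← transpose_nonsing_inv, nonsing_inv_nonsing_inv _
      (isUnit_iff_ne_zero.mpr hP)]
    rfl
  have hSinv : (Rᵀ * R)⁻¹ = ((R⁻¹)ᵀ)ᵀ * (R⁻¹)ᵀ := by
    rw [Matrix.mul_inv_rev, transpose_transpose, transpose_nonsing_inv]
  simp only [hinv, hSinv, ← gaussian_kronecker]
  refine ⟨by rw [hdet]; exact hdet0, fun r => summable_gaussian_intVec_add hQ hw' r, ?_,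
    fun r => ?_⟩
  · simpa using summable_gaussian_intVec_add hQ' (fun q => hw q.1) 0
  rw [tsum_gaussian_intVec_add hQ hw' r, hQinv, hdet]
  simp only [inv_inv]
  congr 1
  rw [det_kronecker, hP', Fintype.prod_prod_type, hk]
  -- Each principal square root occurs `2k` times, so no choice of branch remains.
  have hsq (i : n) : ∏ _u : ι, (1 / (w i)⁻¹) ^ (1 / 2 : ℂ) = w i ^ k := by
    rw [Finset.prod_const, Finset.card_univ, hk, pow_mul, one_div, inv_inv, one_div,
      Complex.cpow_ofNat_inv_pow]
  simp only [hsq, Finset.prod_pow]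
  rw [abs_mul, abs_pow, abs_pow, abs_inv, inv_pow, mul_inv, inv_inv, pow_mul, sq_abs]
  push_cast
  ring

end SiegelGaussian

/-! ### Lattices and their localizations -/

section Localization

open Module

variable {V : Type*} [AddCommGroup V] [Module ℚ V]

lemma one_tmul_mem_localize (p : ℕ) [Fact p.Prime] {L : Submodule ℤ V} {v : V} (hv : v ∈ L) :
    (1 : ℚ_[p]) ⊗ₜ[ℚ] v ∈ localize p L :=
  Submodule.subset_span ⟨v, hv, rfl⟩

lemma localize_mono (p : ℕ) [Fact p.Prime] {L M : Submodule ℤ V} (h : L ≤ M) :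
    localize p L ≤ localize p M :=
  Submodule.span_mono (Set.image_mono h)

lemma isUnit_natCast_padicInt {p u : ℕ} [Fact p.Prime] (hu : ¬ p ∣ u) : IsUnit (u : ℤ_[p]) := by
  rw [PadicInt.isUnit_iff]
  refine le_antisymm (PadicInt.norm_le_one _) (not_lt.mp fun h => hu ?_)
  exact (PadicInt.norm_natCast_lt_one_iff).mp h

/-- Lattices whose quotient is killed by an integer prime to `p` have the same localization
at `p`. -/
lemma localize_eq_of_smul_le {p u : ℕ} [Fact p.Prime] (hu : ¬ p ∣ u) {L M : Submodule ℤ V}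
    (hLM : L ≤ M) (hM : ∀ v ∈ M, (u : ℤ) • v ∈ L) : localize p L = localize p M := by
  refine le_antisymm (localize_mono p hLM) (Submodule.span_le.mpr ?_)
  rintro _ ⟨v, hv, rfl⟩
  obtain ⟨e, he⟩ := isUnit_natCast_padicInt hu
  have h1 : (u : ℤ_[p]) • ((1 : ℚ_[p]) ⊗ₜ[ℚ] v) = (1 : ℚ_[p]) ⊗ₜ[ℚ] ((u : ℤ) • v) := by
    rw [natCast_zsmul, Nat.cast_smul_eq_nsmul, TensorProduct.tmul_smul]
  have h2 : (1 : ℚ_[p]) ⊗ₜ[ℚ] v = (↑e⁻¹ : ℤ_[p]) • ((1 : ℚ_[p]) ⊗ₜ[ℚ] ((u : ℤ) • v)) := by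
    rw [← h1, ← he, smul_smul, Units.inv_mul, one_smul]
  change (1 : ℚ_[p]) ⊗ₜ[ℚ] v ∈ localize p L
  rw [h2]
  exact Submodule.smul_mem _ _ (one_tmul_mem_localize p (hM v hv))

variable {ι : Type*}

lemma localize_span_range (p : ℕ) [Fact p.Prime] (v : ι → V) :
    localize p (Submodule.span ℤ (Set.range v)) =
      Submodule.span ℤ_[p] (Set.range fun i => (1 : ℚ_[p]) ⊗ₜ[ℚ] v i) := by
  refine le_antisymm (Submodule.span_le.mpr ?_) (Submodule.span_le.mpr ?_)
  · rintro _ ⟨x, hx, rfl⟩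
    induction hx using Submodule.span_induction with
    | mem x hx =>
      obtain ⟨i, rfl⟩ := hx
      exact Submodule.subset_span ⟨i, rfl⟩
    | zero => simp
    | add x y _ _ hx hy =>
      beta_reduce
      rw [TensorProduct.tmul_add]
      exact add_mem hx hy
    | smul a x _ hx =>
      beta_reduce
      rw [TensorProduct.tmul_smul]
      exact zsmul_mem hx a
  · rintro _ ⟨i, rfl⟩
    exact one_tmul_mem_localize p (Submodule.subset_span ⟨i, rfl⟩)

lemma mem_localize_span_basis_iff (p : ℕ) [Fact p.Prime] (b : Basis ι ℚ V)
    (x : ℚ_[p] ⊗[ℚ] V) :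
    x ∈ localize p (Submodule.span ℤ (Set.range b)) ↔
      ∀ i, (b.baseChange ℚ_[p]).repr x i ∈ Set.range (algebraMap ℤ_[p] ℚ_[p]) := by
  rw [localize_span_range, ← Basis.mem_span_iff_repr_mem,
    show ⇑(b.baseChange ℚ_[p]) = fun i => (1 : ℚ_[p]) ⊗ₜ[ℚ] b i from
      funext fun i => Basis.baseChange_apply _ _ _]

lemma exists_intCast_of_forall_padic {q : ℚ}
    (h : ∀ (p : ℕ) [Fact p.Prime], (q : ℚ_[p]) ∈ Set.range (algebraMap ℤ_[p] ℚ_[p])) :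
    ∃ j : ℤ, (j : ℚ) = q := by
  refine ⟨q.num, (Rat.den_eq_one_iff q).mp ?_⟩
  by_contra hden
  obtain ⟨p, hp, hpd⟩ := Nat.exists_prime_and_dvd hden
  have : Fact p.Prime := ⟨hp⟩
  obtain ⟨z, hz⟩ := h p
  have h1 : ‖(q : ℚ_[p])‖ ≤ 1 := by
    rw [← hz]
    exact z.norm_le_one
  have h2 := PadicInt.isUnit_iff.mp (PadicInt.isUnit_den q h1)
  exact (PadicInt.norm_natCast_lt_one_iff.mpr hpd).ne h2

/-- A lattice is determined by its localizations. -/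
lemma mem_span_basis_of_forall_localize (b : Basis ι ℚ V) {v : V}
    (h : ∀ (p : ℕ) [Fact p.Prime],
      (1 : ℚ_[p]) ⊗ₜ[ℚ] v ∈ localize p (Submodule.span ℤ (Set.range b))) :
    v ∈ Submodule.span ℤ (Set.range b) := by
  rw [Basis.mem_span_iff_repr_mem]
  intro i
  refine exists_intCast_of_forall_padic fun p _ => ?_
  have := (mem_localize_span_basis_iff p b _).mp (h p) i
  rw [Basis.baseChange_repr_tmul] at this
  simpa [Algebra.smul_def] using this

lemma exists_basis_span_eq (L : Submodule ℤ V) [Submodule.IsLattice ℚ L] :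
    ∃ b : Basis (Fin (Module.finrank ℤ L)) ℚ V, Submodule.span ℤ (Set.range b) = L := by
  let e := Module.finBasis ℤ L
  refine ⟨e.extendOfIsLattice ℚ, ?_⟩
  have h1 : Set.range (e.extendOfIsLattice ℚ) = L.subtype '' Set.range e := by
    rw [← Set.range_comp]
    congr 1
    ext i
    simp
  rw [h1, ← Submodule.map_span, e.span_eq, Submodule.map_subtype_top]

lemma le_of_forall_localize_le {L M : Submodule ℤ V} (hM : Submodule.IsLattice ℚ M)
    (h : ∀ (p : ℕ) [Fact p.Prime], localize p L ≤ localize p M) : L ≤ M := by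
  obtain ⟨b, hb⟩ := exists_basis_span_eq M
  intro v hv
  rw [← hb]
  refine mem_span_basis_of_forall_localize b fun p _ => ?_
  rw [hb]
  exact h p (one_tmul_mem_localize p hv)

/-- Localization commutes with taking duals. -/
lemma localize_dualSubmodule [Finite ι] [DecidableEq ι] {B : LinearMap.BilinForm ℚ V}
    (hB : B.Nondegenerate) (b : Basis ι ℚ V) (p : ℕ) [Fact p.Prime] :
    localize p (B.dualSubmodule (Submodule.span ℤ (Set.range b))) =
      (LinearMap.BilinForm.baseChange ℚ_[p] B).dualSubmodule
        (localize p (Submodule.span ℤ (Set.range b))) := by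
  cases nonempty_fintype ι
  rw [LinearMap.BilinForm.dualSubmodule_span_of_basis B hB b]
  -- Coordinates in the dual basis are pairings with the `b i`, so integral coordinates amount to
  -- integral pairing with the lattice.
  have key (x : ℚ_[p] ⊗[ℚ] V) (i : ι) :
      ((B.dualBasis hB b).baseChange ℚ_[p]).repr x i =
        LinearMap.BilinForm.baseChange ℚ_[p] B x ((1 : ℚ_[p]) ⊗ₜ[ℚ] b i) := by
    induction x using TensorProduct.induction_on with
    | zero => simp
    | add x y hx hy => simp only [map_add, Finsupp.add_apply, hx, hy, LinearMap.add_apply]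
    | tmul a v =>
      rw [Basis.baseChange_repr_tmul, LinearMap.BilinForm.baseChange_tmul,
        LinearMap.BilinForm.dualBasis_repr_apply, mul_one]
  ext x
  rw [mem_localize_span_basis_iff, LinearMap.BilinForm.mem_dualSubmodule]
  simp only [key, Submodule.mem_one]
  constructor
  · intro h y hy
    rw [localize_span_range] at hy
    induction hy using Submodule.span_induction with
    | mem y hy =>
      obtain ⟨i, rfl⟩ := hy
      exact h i
    | zero => exact ⟨0, by simp⟩
    | add y z _ _ hy hz =>
      obtain ⟨r, hr⟩ := hy
      obtain ⟨s, hs⟩ := hz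
      exact ⟨r + s, by rw [map_add, map_add, hr, hs]⟩
    | smul a y _ hy =>
      obtain ⟨r, hr⟩ := hy
      refine ⟨a * r, ?_⟩
      rw [← IsScalarTower.algebraMap_smul ℚ_[p] a y, map_smul, map_mul, hr, smul_eq_mul]
  · intro h i
    exact h _ (one_tmul_mem_localize p (Submodule.subset_span ⟨i, rfl⟩))

end Localization

/-! ### The partial dual lattice -/

section PartialDual

open Module

variable {V : Type*} [AddCommGroup V] [Module ℚ V] {B : LinearMap.BilinForm ℚ V}
  {L : Submodule ℤ V}

/-- The integers as a subring of the rationals. -/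
abbrev ratInt : Subring ℚ := (Int.castRingHom ℚ).range

lemma mem_ratInt {q : ℚ} : q ∈ ratInt ↔ ∃ j : ℤ, (j : ℚ) = q := Iff.rfl

lemma mem_dualSubmodule_iff {x : V} : x ∈ B.dualSubmodule L ↔ ∀ y ∈ L, B x y ∈ ratInt := by
  simp [LinearMap.BilinForm.mem_dualSubmodule, Submodule.mem_one]

lemma map_zsmul_left (n : ℤ) (x y : V) : B (n • x) y = n * B x y := by
  rw [← Int.cast_smul_eq_zsmul ℚ, map_smul, LinearMap.smul_apply, smul_eq_mul]

lemma map_zsmul_right (n : ℤ) (x y : V) : B x (n • y) = n * B x y := by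
  rw [← Int.cast_smul_eq_zsmul ℚ, map_smul, smul_eq_mul]

lemma IsLevel.half_mem {N : ℕ} (hN : IsLevel B L N) {x : V} (hx : x ∈ B.dualSubmodule L) :
    N * B x x / 2 ∈ ratInt := by
  obtain ⟨j, hj⟩ := hN.1.2 x hx
  exact ⟨j, by simp [hj]⟩

namespace IsEvenPosDefLattice

variable (hL : IsEvenPosDefLattice B L)
include hL

lemma isSymm : B.IsSymm := ⟨hL.symm⟩

lemma nondegenerate : B.Nondegenerate := by
  constructor
  · intro x hx
    by_contra h
    exact (hL.posDef x h).ne' (hx x)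
  · intro x hx
    by_contra h
    exact (hL.posDef x h).ne' (hx x)

lemma half_mem {x : V} (hx : x ∈ L) : B x x / 2 ∈ ratInt := by
  obtain ⟨j, hj⟩ := hL.even x hx
  exact ⟨j, by simp [hj]⟩

/-- Polarization of the integral quadratic form `B x x / 2`. -/
lemma integral {x y : V} (hx : x ∈ L) (hy : y ∈ L) : B x y ∈ ratInt := by
  have h := sub_mem (sub_mem (hL.half_mem (add_mem hx hy)) (hL.half_mem hx)) (hL.half_mem hy)
  convert h using 1
  simp only [map_add, LinearMap.add_apply, hL.symm y x]
  ring

lemma le_dualSubmodule : L ≤ B.dualSubmodule L := fun _ hx =>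
  mem_dualSubmodule_iff.mpr fun _ hy => hL.integral hx hy

lemma dualSubmodule_dualSubmodule : B.dualSubmodule (B.dualSubmodule L) = L := by
  have := hL.isLattice
  obtain ⟨b, hb⟩ := exists_basis_span_eq L
  have h := LinearMap.BilinForm.dualSubmodule_dualSubmodule_of_basis (R := ℤ) B hL.nondegenerate
    hL.isSymm b
  rwa [hb] at h

lemma isLattice_dualSubmodule : Submodule.IsLattice ℚ (B.dualSubmodule L) := by
  have := hL.isLattice
  obtain ⟨b, hb⟩ := exists_basis_span_eq L
  have h := LinearMap.BilinForm.dualSubmodule_span_of_basis (R := ℤ) B hL.nondegenerate b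
  rw [hb] at h
  refine Submodule.IsLattice.of_le_of_isLattice_of_fg ℚ hL.le_dualSubmodule ?_
  rw [h]
  exact Submodule.fg_span (Set.finite_range _)

variable {N : ℕ} (hN : IsLevel B L N)
include hN

lemma level_integral {x y : V} (hx : x ∈ B.dualSubmodule L) (hy : y ∈ B.dualSubmodule L) :
    N * B x y ∈ ratInt := by
  have h := sub_mem (sub_mem (hN.half_mem (add_mem hx hy)) (hN.half_mem hx))
    (hN.half_mem hy)
  convert h using 1
  simp only [map_add, LinearMap.add_apply, hL.symm y x]
  ring

/-- `N B` is integral on `L*` by polarization, so `N L*` lies in the bidual, which is `L`. -/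
lemma level_smul_mem {x : V} (hx : x ∈ B.dualSubmodule L) : (N : ℤ) • x ∈ L := by
  rw [← hL.dualSubmodule_dualSubmodule]
  refine mem_dualSubmodule_iff.mpr fun y hy => ?_
  rw [map_zsmul_left]
  exact_mod_cast hL.level_integral hN hx hy

end IsEvenPosDefLattice

/-- The lattice of dual vectors `x` with `d x ∈ L`. -/
def partialDual (B : LinearMap.BilinForm ℚ V) (L : Submodule ℤ V) (d : ℕ) : Submodule ℤ V :=
  B.dualSubmodule L ⊓ L.comap (LinearMap.lsmul ℤ V (d : ℤ))

lemma mem_partialDual {d : ℕ} {x : V} :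
    x ∈ partialDual B L d ↔ x ∈ B.dualSubmodule L ∧ (d : ℤ) • x ∈ L := Iff.rfl

/-- Write `L'` for the partial dual. If `p ∤ d`, then `d` is a `p`-adic unit and `dL' ⊆ L ⊆ L'`. If
`p ∣ d`, then `c` is a unit by coprimality, and `cL* ⊆ L' ⊆ L*` because `dcL* = NL* ⊆ L`. -/
lemma isPartialDual_partialDual (hL : IsEvenPosDefLattice B L) {N c d : ℕ}
    (hN : IsLevel B L N) (hcd : N = c * d) (hcop : Nat.Coprime d c) :
    IsPartialDual B L d (partialDual B L d) := by
  have := hL.isLattice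
  have hle : L ≤ partialDual B L d := fun x hx =>
    mem_partialDual.mpr ⟨hL.le_dualSubmodule hx, L.smul_mem _ hx⟩
  obtain ⟨b, hb⟩ := exists_basis_span_eq L
  refine ⟨?_, fun p _ hp => ?_, fun p _ hp => ?_⟩
  · refine Submodule.IsLattice.of_le_of_isLattice_of_fg ℚ hle ?_
    have h1 := hL.isLattice_dualSubmodule
    have h2 : IsNoetherian ℤ (B.dualSubmodule L) := by
      have := Submodule.IsLattice.finite ℚ (B.dualSubmodule L)
      infer_instance
    have h3 : IsNoetherian ℤ (partialDual B L d) := isNoetherian_of_le inf_le_left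
    rw [← Module.Finite.iff_fg]
    infer_instance
  · exact (localize_eq_of_smul_le hp hle fun v hv => hv.2).symm
  · have h := localize_dualSubmodule hL.nondegenerate b p
    rw [hb] at h
    rw [← h]
    have hpc : ¬ p ∣ c := fun hpc =>
      (Fact.out : p.Prime).one_lt.ne' (Nat.dvd_one.mp (hcop ▸ Nat.dvd_gcd hp hpc))
    refine localize_eq_of_smul_le hpc inf_le_left fun v hv => ⟨Submodule.smul_mem _ _ hv, ?_⟩
    have := hL.level_smul_mem hN hv
    rw [hcd, mul_comm, Nat.cast_mul, mul_smul] at this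
    exact this

lemma IsPartialDual.unique {d : ℕ} {M M' : Submodule ℤ V} (h : IsPartialDual B L d M)
    (h' : IsPartialDual B L d M') : M = M' := by
  have key (p : ℕ) [Fact p.Prime] : localize p M = localize p M' := by
    by_cases hp : p ∣ d
    · rw [h.of_dvd p hp, h'.of_dvd p hp]
    · rw [h.of_not_dvd p hp, h'.of_not_dvd p hp]
  exact le_antisymm (le_of_forall_localize_le h'.isLattice fun p _ => (key p).le)
    (le_of_forall_localize_le h.isLattice fun p _ => (key p).ge)

end PartialDual

/-! ### Gauss sums on the dual lattice -/

section GaussSum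

open Module

/-- The additive character `q ↦ exp (2πiq)` of `ℚ`. -/
noncomputable def expRat (q : ℚ) : ℂ := Complex.exp (2 * Real.pi * Complex.I * q)

lemma expRat_add (p q : ℚ) : expRat (p + q) = expRat p * expRat q := by
  rw [expRat, expRat, expRat, ← Complex.exp_add]
  push_cast
  ring_nf

lemma expRat_eq_one_iff {q : ℚ} : expRat q = 1 ↔ q ∈ ratInt := by
  rw [expRat, Complex.exp_eq_one_iff, mem_ratInt]
  refine exists_congr fun j => ?_
  rw [mul_comm (2 * Real.pi * Complex.I : ℂ)]
  constructor
  · intro h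
    exact_mod_cast (mul_right_cancel₀ Complex.two_pi_I_ne_zero h).symm
  · intro h
    rw [← h]
    push_cast
    rfl

lemma expRat_eq_of_sub_mem {p q : ℚ} (h : p - q ∈ ratInt) : expRat p = expRat q := by
  rw [← sub_add_cancel p q, expRat_add, expRat_eq_one_iff.mpr h, one_mul]

/-- Translation by `t` permutes the residue classes but not the chosen representatives; periodicity
absorbs the resulting multiples of `c`. -/
lemma sum_zmod_cast_add {ι : Type*} [Fintype ι] [DecidableEq ι] {c : ℕ} [NeZero c]
    {F : (ι → ℤ) → ℂ} (hF : ∀ x y, F (x + (c : ℤ) • y) = F x) (t : ι → ℤ) :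
    ∑ r : ι → ZMod c, F ((fun s => (r s).cast) + t) = ∑ r : ι → ZMod c, F fun s => (r s).cast := by
  rw [← Equiv.sum_comp (Equiv.addRight fun s => (t s : ZMod c)) fun r : ι → ZMod c =>
    F fun s => (r s).cast]
  refine Finset.sum_congr rfl fun r _ => ?_
  have h (s : ι) : ∃ y : ℤ, (r s).cast + t s = (r s + (t s : ZMod c)).cast + c * y := by
    have : ((c : ℕ) : ℤ) ∣ ((r s).cast + t s) - (r s + (t s : ZMod c)).cast := by
      rw [← ZMod.intCast_eq_intCast_iff_dvd_sub]
      push_cast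
      simp
    obtain ⟨y, hy⟩ := this
    exact ⟨y, by linarith⟩
  choose y hy using h
  rw [show (fun s => (r s).cast) + t = (fun s => (r s + (t s : ZMod c)).cast) + (c : ℤ) • y from
    funext fun s => by simp [hy s], hF]
  rfl

variable {V : Type*} [AddCommGroup V] [Module ℚ V] {B : LinearMap.BilinForm ℚ V}
  {L : Submodule ℤ V}

/-- The phase of the Gauss sum attached to `(a, b; c, d)`. -/
def phase (B : LinearMap.BilinForm ℚ V) (a : ℤ) (c d : ℕ) (ξ x : V) : ℚ :=
  (a * B x x + 2 * B ξ x + d * B ξ ξ) / (2 * c)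

variable {ι : Type*} [Fintype ι] [DecidableEq ι]

/-- The integral combination of the vectors `v` with coefficients `t`. -/
def intComb (v : ι → V) (t : ι → ℤ) : V := ∑ s, t s • v s

omit [DecidableEq ι] [Module ℚ V] in
lemma intComb_add (v : ι → V) (s t : ι → ℤ) : intComb v (s + t) = intComb v s + intComb v t := by
  simp [intComb, add_smul, Finset.sum_add_distrib]

omit [DecidableEq ι] [Module ℚ V] in
lemma intComb_smul (v : ι → V) (m : ℤ) (t : ι → ℤ) : intComb v (m • t) = m • intComb v t := by
  simp [intComb, Finset.smul_sum, mul_smul]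

omit [DecidableEq ι] [Module ℚ V] in
lemma mem_span_iff_exists_intComb (v : ι → V) {x : V} :
    x ∈ Submodule.span ℤ (Set.range v) ↔ ∃ t, intComb v t = x :=
  Submodule.mem_span_range_iff_exists_fun ℤ

omit [DecidableEq ι] [Module ℚ V] in
lemma intComb_mem {v : ι → V} (hv : Submodule.span ℤ (Set.range v) = L) (t : ι → ℤ) :
    intComb v t ∈ L :=
  hv ▸ (mem_span_iff_exists_intComb v).mpr ⟨t, rfl⟩

/-- The Gauss sum `∑_{r ∈ L/cL} exp (πi (a B(r,r) + 2 B(ξ,r) + d B(ξ,ξ)) / c)`. -/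
noncomputable def gaussSum (B : LinearMap.BilinForm ℚ V) (v : ι → V) (a : ℤ) (c d : ℕ) [NeZero c]
    (ξ : V) : ℂ :=
  ∑ r : ι → ZMod c, expRat (phase B a c d ξ (intComb v fun s => (r s).cast))

section

variable (hL : IsEvenPosDefLattice B L) {a b : ℤ} {c d : ℕ} [NeZero c]
include hL

/-- Makes the Gauss sum a sum over `L/cL`. The quadratic term contributes `a c B(y,y)/2`, integral
because `L` is even. -/
lemma phase_add_smul_sub_mem {ξ x y : V} (hξ : ξ ∈ B.dualSubmodule L) (hx : x ∈ L) (hy : y ∈ L) :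
    phase B a c d ξ (x + (c : ℤ) • y) - phase B a c d ξ x ∈ ratInt := by
  have hc : (c : ℚ) ≠ 0 := NeZero.ne _
  have h : phase B a c d ξ (x + (c : ℤ) • y) - phase B a c d ξ x =
      (a : ℚ) * B x y + a * c * (B y y / 2) + B ξ y := by
    simp only [phase, map_add, LinearMap.add_apply, map_zsmul_left, map_zsmul_right, hL.symm y x]
    field_simp
    push_cast
    ring
  rw [h]
  exact add_mem (add_mem (mul_mem (intCast_mem _ _) (hL.integral hx hy))
    (mul_mem (mul_mem (intCast_mem _ _) (natCast_mem _ _)) (hL.half_mem hy)))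
    (mem_dualSubmodule_iff.mp hξ y hy)

/-- Since `ad = 1 + bc`, moving `ξ` by `η ∈ L` has the same effect modulo `1` as moving `x` by `dη`.
-/
lemma phase_add_sub_mem (hdet : a * d - b * c = 1) {ξ x η : V} (hx : x ∈ L) (hη : η ∈ L) :
    phase B a c d (ξ + η) x - phase B a c d ξ (x + (d : ℤ) • η) ∈ ratInt := by
  have hc : (c : ℚ) ≠ 0 := NeZero.ne _
  have hdet' : (a : ℚ) * d = 1 + b * c := by
    have : (a : ℚ) * d - b * c = 1 := by exact_mod_cast hdet
    linarith
  have h : phase B a c d (ξ + η) x - phase B a c d ξ (x + (d : ℤ) • η) =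
      -((b : ℚ) * B x η + b * d * (B η η / 2)) := by
    simp only [phase, map_add, LinearMap.add_apply, map_zsmul_left, map_zsmul_right, hL.symm η x,
      hL.symm η ξ]
    field_simp
    push_cast
    linear_combination (-2 * B x η - d * B η η) * hdet'
  rw [h]
  exact neg_mem (add_mem (mul_mem (intCast_mem _ _) (hL.integral hx hη))
    (mul_mem (mul_mem (intCast_mem _ _) (natCast_mem _ _)) (hL.half_mem hη)))

/-- The definition of the level enters here: the error contains `N B(ζ,ζ)/2`. -/
lemma phase_smul_add_sub_mem {N : ℕ} (hN : IsLevel B L N) (hcd : N = c * d) {ξ x ζ : V}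
    (hζ : ζ ∈ B.dualSubmodule L) (hx : x ∈ L) :
    phase B a c d (ξ + (c : ℤ) • ζ) x - (d * B ξ ζ + phase B a c d ξ x) ∈ ratInt := by
  have hc : (c : ℚ) ≠ 0 := NeZero.ne _
  have h : phase B a c d (ξ + (c : ℤ) • ζ) x - (d * B ξ ζ + phase B a c d ξ x) =
      B ζ x + N * B ζ ζ / 2 := by
    simp only [phase, map_add, LinearMap.add_apply, map_zsmul_left, map_zsmul_right, hL.symm ζ ξ,
      hcd]
    field_simp
    push_cast
    ring
  rw [h]
  exact add_mem (mem_dualSubmodule_iff.mp hζ x hx) (hN.half_mem hζ)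

variable {v : ι → V} (hv : Submodule.span ℤ (Set.range v) = L)
include hv

/-- The shift `r ↦ r + dη` permutes `L/cL`. -/
lemma gaussSum_add (hdet : a * d - b * c = 1) {ξ η : V} (hξ : ξ ∈ B.dualSubmodule L)
    (hη : η ∈ L) : gaussSum B v a c d (ξ + η) = gaussSum B v a c d ξ := by
  obtain ⟨t, ht⟩ := (mem_span_iff_exists_intComb v).mp (hv.symm ▸ L.smul_mem (d : ℤ) hη)
  have h := sum_zmod_cast_add (c := c) (F := fun x => expRat (phase B a c d ξ (intComb v x)))
    (fun x y => by
      rw [intComb_add, intComb_smul]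
      exact expRat_eq_of_sub_mem
        (phase_add_smul_sub_mem hL hξ (intComb_mem hv x) (intComb_mem hv y))) t
  rw [gaussSum, gaussSum, ← h]
  refine Finset.sum_congr rfl fun r _ => ?_
  rw [intComb_add, ht]
  exact expRat_eq_of_sub_mem (phase_add_sub_mem hL hdet (intComb_mem hv _) hη)

variable {N : ℕ} (hN : IsLevel B L N) (hcd : N = c * d)
include hN hcd

lemma gaussSum_add_smul {ξ ζ : V} (hζ : ζ ∈ B.dualSubmodule L) :
    gaussSum B v a c d (ξ + (c : ℤ) • ζ) = expRat (d * B ξ ζ) * gaussSum B v a c d ξ := by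
  rw [gaussSum, gaussSum, Finset.mul_sum]
  refine Finset.sum_congr rfl fun r _ => ?_
  rw [← expRat_add]
  exact expRat_eq_of_sub_mem (phase_smul_add_sub_mem hL hN hcd hζ (intComb_mem hv _))

/-- Write `ξ = c(-bξ) + a(dξ)`. The second summand lies in `L`, and the first moves the argument
from `0`, where the multiplier is trivial. -/
lemma gaussSum_of_mem (hdet : a * d - b * c = 1) {ξ : V} (hξ : ξ ∈ partialDual B L d) :
    gaussSum B v a c d ξ = gaussSum B v a c d 0 := by
  have hζ : (-b) • ξ ∈ B.dualSubmodule L := Submodule.smul_mem _ _ hξ.1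
  have h1 := gaussSum_add_smul (a := a) hL hv hN hcd (ξ := 0) hζ
  have h2 := gaussSum_add hL hv hdet (ξ := 0 + (c : ℤ) • (-b) • ξ)
    (add_mem (zero_mem _) (Submodule.smul_mem _ _ hζ)) (L.smul_mem a (mem_partialDual.mp hξ).2)
  have h3 : (0 : V) + (c : ℤ) • (-b) • ξ + a • (d : ℤ) • ξ = ξ := by
    rw [zero_add, smul_smul, smul_smul, ← add_smul,
      show (c : ℤ) * -b + a * d = 1 by linarith, one_smul]
  rw [h3, h1] at h2
  simpa [expRat] using h2

/-- If `ζ ∈ L*` and `cζ ∈ L`, the two transformation rules for `ξ + cζ` agree only if the sum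
vanishes or `d B(ξ,ζ)` is an integer. A nonzero sum thus puts `dξ` in the bidual of `L`. -/
lemma gaussSum_of_notMem (hdet : a * d - b * c = 1) {ξ : V} (hξ : ξ ∈ B.dualSubmodule L)
    (hξ' : ξ ∉ partialDual B L d) : gaussSum B v a c d ξ = 0 := by
  by_contra hne
  refine hξ' (mem_partialDual.mpr ⟨hξ, ?_⟩)
  have key (ζ : V) (hζ : ζ ∈ B.dualSubmodule L) (hcζ : (c : ℤ) • ζ ∈ L) :
      d * B ξ ζ ∈ ratInt := by
    have h1 := gaussSum_add_smul (a := a) hL hv hN hcd (ξ := ξ) hζ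
    rw [gaussSum_add hL hv hdet hξ hcζ] at h1
    exact expRat_eq_one_iff.mp (mul_eq_right₀ hne |>.mp h1.symm)
  rw [← hL.dualSubmodule_dualSubmodule]
  refine mem_dualSubmodule_iff.mpr fun η hη => ?_
  -- Taking `ζ = dη` is allowed as `cdη = Nη ∈ L`, and shows that `d² B(ξ,η)` is integral. So is `cd
  -- B(ξ,η)`, hence also `d B(ξ,η) = (ad - bc) d B(ξ,η)`.
  have h1 := key ((d : ℤ) • η) (Submodule.smul_mem _ _ hη) (by
    have := hL.level_smul_mem hN hη
    rw [hcd, Nat.cast_mul, mul_smul] at this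
    exact this)
  have h2 := sub_mem (mul_mem (intCast_mem ratInt a) h1)
    (mul_mem (intCast_mem ratInt b) (hL.level_integral hN hξ hη))
  have hdet' : (a : ℚ) * d - b * c = 1 := by exact_mod_cast hdet
  convert h2 using 1
  simp only [map_zsmul_left, map_zsmul_right, hcd]
  push_cast
  linear_combination -(d * B ξ η) * hdet'

end

end GaussSum

/-! ### Splitting sums into residue classes -/

section ResidueClasses

open Matrix

variable {κ : Type*} {c : ℕ} [NeZero c]

/-- The integer vector with residue representatives `r` and quotient `y`. -/
def residueVec (r : κ → ZMod c) (y : κ → ℤ) : κ → ℤ := (fun s => (r s).cast) + (c : ℤ) • y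

lemma residueVec_bijective :
    Function.Bijective fun p : (κ → ZMod c) × (κ → ℤ) => residueVec p.1 p.2 := by
  constructor
  · rintro ⟨r, y⟩ ⟨r', y'⟩ h
    have h1 : r = r' := by
      ext s
      have := congrArg (Int.cast : ℤ → ZMod c) (congrFun h s)
      simpa [residueVec] using this
    subst h1
    refine Prod.ext rfl (funext fun s => ?_)
    have := congrFun h s
    simpa [residueVec, NeZero.ne c] using this
  · intro x
    have h (s : κ) : ∃ y : ℤ, ((x s : ZMod c).cast : ℤ) + c * y = x s := by
      have : ((c : ℕ) : ℤ) ∣ x s - (x s : ZMod c).cast := by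
        rw [← ZMod.intCast_eq_intCast_iff_dvd_sub]
        simp
      obtain ⟨y, hy⟩ := this
      exact ⟨y, by linarith⟩
    choose y hy using h
    exact ⟨⟨fun s => x s, y⟩, funext fun s => by simp [residueVec, hy s]⟩

/-- A sum over `ℤ^κ` splits into the sums over the residue classes modulo `c`. -/
lemma tsum_eq_sum_tsum_residueVec [Fintype κ] [DecidableEq κ] {H : (κ → ℤ) → ℂ}
    (hH : ∀ r : κ → ZMod c, Summable fun y => H (residueVec r y)) :
    ∑' x, H x = ∑ r : κ → ZMod c, ∑' y, H (residueVec r y) := by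
  let e := Equiv.ofBijective _ (residueVec_bijective (κ := κ) (c := c))
  have hs : Summable fun p : (κ → ZMod c) × (κ → ℤ) => H (e p) := by
    refine Summable.of_norm ((summable_prod_of_nonneg fun _ => norm_nonneg _).mpr
      ⟨fun r => (hH r).norm, (hasSum_fintype _).summable⟩)
  rw [← e.tsum_eq, hs.tsum_prod' hH, tsum_fintype]
  rfl

end ResidueClasses

/-! ### Gram matrices and sums over tuples -/

section Gram

open Matrix

open Module

variable {V : Type*} [AddCommGroup V] [Module ℚ V] {B : LinearMap.BilinForm ℚ V}
  {L : Submodule ℤ V} {ι : Type*} [Fintype ι]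

lemma intComb_injective (b : Basis ι ℚ V) : Function.Injective (intComb b) := by
  intro s t h
  ext i
  have h1 (t : ι → ℤ) : intComb b t = ∑ i, (t i : ℚ) • b i := by
    simp [intComb, Int.cast_smul_eq_zsmul]
  rw [h1, h1] at h
  have := congrArg (fun v => b.repr v i) h
  simp only [b.repr_sum_self] at this
  exact_mod_cast this

lemma bilin_intComb (v w : ι → V) (x y : ι → ℤ) :
    B (intComb v x) (intComb w y) = ∑ s, ∑ t, (x s : ℚ) * y t * B (v s) (w t) := by
  simp only [intComb, map_sum, LinearMap.sum_apply, map_zsmul_left, map_zsmul_right]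
  rw [Finset.sum_comm]
  refine Finset.sum_congr rfl fun s _ => Finset.sum_congr rfl fun t _ => by ring

/-- The real Gram matrix of a family of vectors. -/
def realGram (B : LinearMap.BilinForm ℚ V) (v : ι → V) : Matrix ι ι ℝ :=
  of fun s t => (B (v s) (v t) : ℝ)

variable {n : Type*} [Fintype n]

lemma tensorForm_realGram (v : ι → V) (U : Matrix n n ℂ) (X : n × ι → ℤ) :
    tensorForm (realGram B v) U (intVec X) = ∑ i, ∑ j, U i j *
      ((B (intComb v fun s => X (i, s)) (intComb v fun s => X (j, s)) : ℚ) : ℂ) := by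
  refine Finset.sum_congr rfl fun i _ => Finset.sum_congr rfl fun j _ => ?_
  rw [bilin_intComb]
  push_cast
  congr 1
  refine Finset.sum_congr rfl fun s _ => Finset.sum_congr rfl fun t _ => ?_
  simp only [realGram, of_apply, intVec_apply]
  push_cast
  ring

lemma tensorForm_smul (S : Matrix ι ι ℝ) (U : Matrix n n ℂ) (a : ℝ) (x : n × ι → ℝ) :
    tensorForm S U (a • x) = (a : ℂ) ^ 2 * tensorForm S U x := by
  simp only [tensorForm, Finset.mul_sum, Pi.smul_apply, smul_eq_mul, Complex.ofReal_sum]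
  refine Finset.sum_congr rfl fun i _ => Finset.sum_congr rfl fun j _ =>
    Finset.sum_congr rfl fun s _ => Finset.sum_congr rfl fun t _ => ?_
  push_cast
  ring

omit [Fintype n] in
/-- Sums over tuples of a sublattice, in coordinates. -/
lemma tsum_tuple_eq_tsum_intComb (b : Basis ι ℚ V) {M : Submodule ℤ V}
    (hM : M ≤ Submodule.span ℤ (Set.range b)) {F : (n → V) → ℂ}
    (hF : ∀ x : n → V, (∀ i, x i ∈ Submodule.span ℤ (Set.range b)) → F x ≠ 0 → ∀ i, x i ∈ M) :
    ∑' x : n → M, F (fun i => x i) =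
      ∑' X : n × ι → ℤ, F fun i => intComb b fun s => X (i, s) := by
  choose g hg using fun x : M => (mem_span_iff_exists_intComb b).mp (hM x.2)
  let G : (n → M) → n × ι → ℤ := fun x q => g (x q.1) q.2
  have hG (x : n → M) (i : n) : intComb b (fun s => G x (i, s)) = x i := hg (x i)
  have hinj : Function.Injective G := fun x y h => funext fun i => Subtype.ext (by
    rw [← hG x, ← hG y, h])
  rw [← hinj.tsum_eq]
  · simp only [hG]
  · intro X hX
    have hmem := hF _ (fun i => (mem_span_iff_exists_intComb b).mpr ⟨_, rfl⟩) hX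
    refine ⟨fun i => ⟨_, hmem i⟩, funext fun q => ?_⟩
    have := intComb_injective b (hG (fun i => ⟨_, hmem i⟩) q.1)
    exact congrFun this q.2

variable [DecidableEq ι]

/-- The Gram matrix of `b` is the matrix expressing `b` in the dual basis; pairing that expansion
with the dual basis gives the identity. -/
lemma realGram_mul_realGram_dualBasis (hB : B.Nondegenerate) (hs : B.IsSymm) (b : Basis ι ℚ V) :
    realGram B b * realGram B (B.dualBasis hB b) = 1 := by
  ext s t
  have h : b s = ∑ u, B (b s) (b u) • B.dualBasis hB b u := by
    conv_lhs => rw [← (B.dualBasis hB b).sum_repr (b s)]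
    simp
  have h1 : B (b s) (B.dualBasis hB b t) =
      ∑ u, B (b s) (b u) * B (B.dualBasis hB b u) (B.dualBasis hB b t) := by
    conv_lhs => rw [h]
    simp [LinearMap.sum_apply]
  rw [LinearMap.BilinForm.apply_dualBasis_right hB hs] at h1
  have h2 := congrArg (Rat.cast : ℚ → ℝ) h1
  push_cast at h2
  simp only [realGram, mul_apply, of_apply, ← h2, one_apply]
  split_ifs <;> simp

lemma realGram_inv (hB : B.Nondegenerate) (hs : B.IsSymm) (b : Basis ι ℚ V) :
    (realGram B b)⁻¹ = realGram B (B.dualBasis hB b) :=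
  inv_eq_right_inv (realGram_mul_realGram_dualBasis hB hs b)

/-- Density of rational vectors carries over only semidefiniteness; invertibility of the Gram matrix
then gives definiteness. -/
lemma realGram_posDef (hL : IsEvenPosDefLattice B L) (b : Basis ι ℚ V) :
    (realGram B b).PosDef := by
  have hdet : (realGram B b).det ≠ 0 := fun h => by
    have := congrArg det (realGram_mul_realGram_dualBasis hL.nondegenerate hL.isSymm b)
    rw [det_mul, h, zero_mul, det_one] at this
    exact zero_ne_one this
  refine (PosSemidef.posDef_iff_det_ne_zero ?_).mpr hdet
  refine PosSemidef.of_dotProduct_mulVec_nonneg ?_ fun x => ?_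
  · ext s t
    simp [realGram, hL.symm (b s) (b t)]
  have hd : DenseRange fun y : ι → ℚ => fun s => (y s : ℝ) :=
    DenseRange.piMap fun _ => Rat.denseRange_cast
  refine hd.induction_on x ?_ fun y => ?_
  · refine isClosed_le continuous_const ?_
    unfold dotProduct mulVec dotProduct
    simp only [star_trivial]
    fun_prop
  · have h0 : 0 ≤ B (∑ s, y s • b s) (∑ s, y s • b s) := by
      by_cases hz : ∑ s, y s • b s = 0
      · simp [hz]
      · exact (hL.posDef _ hz).le
    have h1 : (fun s => (y s : ℝ)) ⬝ᵥ realGram B b *ᵥ (fun s => (y s : ℝ)) =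
        (B (∑ s, y s • b s) (∑ s, y s • b s) : ℚ) := by
      simp only [dotProduct, mulVec, realGram, of_apply, map_sum, LinearMap.sum_apply, map_smul,
        LinearMap.smul_apply, smul_eq_mul, Finset.mul_sum, Rat.cast_sum, Rat.cast_mul]
      rw [Finset.sum_comm]
      refine Finset.sum_congr rfl fun s _ => Finset.sum_congr rfl fun t _ => ?_
      rw [hL.symm]
      ring
    rw [star_trivial, h1]
    exact_mod_cast h0

end Gram

/-! ### The slash operator for scalar blocks -/

section Slash

open Matrix

variable {n : ℕ}

lemma slash_diagEmbed (k : ℕ) (M : SL(2, ℤ)) (F : Matrix (Fin n) (Fin n) ℂ → ℂ)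
    (Z : Matrix (Fin n) (Fin n) ℂ) :
    slash k (diagEmbed n M) F Z =
      ((M 1 0 : ℂ) • Z + (M 1 1 : ℂ) • (1 : Matrix (Fin n) (Fin n) ℂ)).det ^ (-(k : ℤ)) *
        F (((M 0 0 : ℂ) • Z + (M 0 1 : ℂ) • (1 : Matrix (Fin n) (Fin n) ℂ)) *
          ((M 1 0 : ℂ) • Z + (M 1 1 : ℂ) • (1 : Matrix (Fin n) (Fin n) ℂ))⁻¹) := by
  have h (m : ℤ) : (m • (1 : Matrix (Fin n) (Fin n) ℤ)).map (Int.cast : ℤ → ℂ) =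
      (m : ℂ) • (1 : Matrix (Fin n) (Fin n) ℂ) := by
    ext i j
    by_cases hij : i = j <;>
      simp only [map_apply, Matrix.smul_apply, one_apply, hij, if_true, if_false, smul_eq_mul, mul_one,
        mul_zero, Int.cast_zero]
  simp only [slash, diagEmbed, fromBlocks_map, toBlocks_fromBlocks₁₁, toBlocks_fromBlocks₁₂,
    toBlocks_fromBlocks₂₁, toBlocks_fromBlocks₂₂, h, smul_mul_assoc, one_mul]

/-- The decomposition of a fractional linear transformation with `c ≠ 0`. -/
lemma smul_add_mul_inv_eq {a b c d : ℂ} (hc : c ≠ 0) (hdet : a * d - b * c = 1)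
    {Z A : Matrix (Fin n) (Fin n) ℂ} (hA : A = (-Complex.I) • (Z + (d / c) • 1))
    (hA0 : A.det ≠ 0) :
    c • Z + d • 1 = (Complex.I * c) • A ∧
      (a • Z + b • 1) * (c • Z + d • 1)⁻¹ = (a / c) • 1 + (Complex.I / c ^ 2) • A⁻¹ := by
  have h1 : c • Z + d • 1 = (Complex.I * c) • A := by
    rw [hA, smul_smul, show Complex.I * c * -Complex.I = c by linear_combination -c * Complex.I_sq,
      smul_add, smul_smul, mul_div_cancel₀ _ hc]
  have hu : IsUnit (c • Z + d • (1 : Matrix (Fin n) (Fin n) ℂ)).det := by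
    rw [h1, det_smul]
    exact (mul_ne_zero (pow_ne_zero _ (mul_ne_zero Complex.I_ne_zero hc)) hA0).isUnit
  refine ⟨h1, ?_⟩
  -- The matrix form of `MZ = a/c - 1/(c(cZ + d))`, cleared of the denominator.
  have h2 : a • Z + b • 1 = ((a / c) • 1 + (Complex.I / c ^ 2) • A⁻¹) * (c • Z + d • 1) := by
    rw [add_mul, smul_mul_assoc, one_mul]
    conv_rhs => rw [h1]
    rw [smul_mul_smul_comm, nonsing_inv_mul _ hA0.isUnit, ← h1, smul_add, smul_smul, smul_smul,
      add_assoc, ← add_smul, div_mul_cancel₀ _ hc]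
    congr 2
    field_simp
    rw [Complex.I_sq]
    linear_combination -hdet
  rw [h2, mul_nonsing_inv_cancel_right _ _ hu]

end Slash

/-! ### Expansion of the transformed theta series -/

section Main

open Matrix

open Module

variable {V : Type*} [AddCommGroup V] [Module ℚ V] {B : LinearMap.BilinForm ℚ V}
  {L : Submodule ℤ V} {n : ℕ}

/-- The summand of the theta series. -/
noncomputable def thetaTerm (B : LinearMap.BilinForm ℚ V) (Z : Matrix (Fin n) (Fin n) ℂ)
    (x : Fin n → V) : ℂ :=
  Complex.exp (Real.pi * Complex.I *
    trace (of (fun i j : Fin n => ((B (x i) (x j) : ℚ) : ℂ)) * Z))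

lemma trace_gram_mul (hs : B.IsSymm) (U : Matrix (Fin n) (Fin n) ℂ) (x : Fin n → V) :
    trace (of (fun i j : Fin n => ((B (x i) (x j) : ℚ) : ℂ)) * U) =
      ∑ i, ∑ j, U i j * ((B (x i) (x j) : ℚ) : ℂ) := by
  simp only [trace, diag_apply, mul_apply, of_apply]
  rw [Finset.sum_comm]
  refine Finset.sum_congr rfl fun i _ => Finset.sum_congr rfl fun j _ => ?_
  rw [hs.eq, mul_comm]

lemma trace_gram_smul_one (x : Fin n → V) (t : ℂ) :
    trace (of (fun i j : Fin n => ((B (x i) (x j) : ℚ) : ℂ)) * (t • (1 : Matrix _ _ ℂ))) =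
      t * ((∑ i, B (x i) (x i) : ℚ) : ℂ) := by
  rw [mul_smul_comm, mul_one, trace_smul, smul_eq_mul]
  simp [trace]

lemma prod_expRat {α : Type*} (s : Finset α) (f : α → ℚ) :
    ∏ i ∈ s, expRat (f i) = expRat (∑ i ∈ s, f i) := by
  simp only [expRat, ← Complex.exp_sum]
  push_cast
  rw [Finset.mul_sum]

variable {ι : Type*} [Fintype ι] [DecidableEq ι]

/-- The phase is additive over the tuple, so the sum over tuples of residues factors. -/
lemma sum_prod_phase {c : ℕ} [NeZero c] (a : ℤ) (d : ℕ) (v : ι → V) (ξ : Fin n → V) :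
    ∑ r : Fin n × ι → ZMod c,
        expRat (∑ i, phase B a c d (ξ i) (intComb v fun s => (r (i, s)).cast)) =
      ∏ i, gaussSum B v a c d (ξ i) := by
  simp only [gaussSum]
  rw [Finset.prod_univ_sum, Fintype.piFinset_univ,
    ← Equiv.sum_comp (Equiv.curry (Fin n) ι (ZMod c))]
  refine Finset.sum_congr rfl fun r _ => ?_
  rw [← prod_expRat]
  rfl

/-- The three summands have different origins: the term `a/c` of `MZ`, the Poisson character, and
the shift `d/c` in `A`. -/
lemma phase_eq_zero_add (a : ℤ) (c d : ℕ) (ξ x : V) :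
    phase B a c d ξ x = phase B a c d 0 x + B ξ x / c + d * B ξ ξ / (2 * c) := by
  simp only [phase, map_zero, LinearMap.zero_apply]
  by_cases hc : (c : ℚ) = 0
  · simp [hc]
  · field_simp
    ring

/-- Expansion of the transformed theta series over tuples of dual vectors, with products of Gauss
sums as coefficients. -/
theorem exists_theta_slash_eq_tsum_gaussSum (hL : IsEvenPosDefLattice B L) (b : Basis ι ℚ V)
    (hb : Submodule.span ℤ (Set.range b) = L) {k : ℕ} (hk : Fintype.card ι = 2 * k)
    (M : SL(2, ℤ)) {c d : ℕ} [NeZero c] (hMc : M 1 0 = c) (hMd : M 1 1 = d) :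
    ∃ C : ℂ, ∀ Z ∈ siegelUpperHalfSpace n, slash k (diagEmbed n M) (theta B n L) Z =
      C * ∑' Ξ : Fin n × ι → ℤ,
        thetaTerm B Z (fun i => intComb (B.dualBasis hL.nondegenerate b) fun s => Ξ (i, s)) *
          ∏ i, gaussSum B b (M 0 0) c d
            (intComb (B.dualBasis hL.nondegenerate b) fun s => Ξ (i, s)) := by
  set β := B.dualBasis hL.nondegenerate b with hβ
  set a := M 0 0 with ha
  have hc0 : (c : ℂ) ≠ 0 := by exact_mod_cast NeZero.ne c
  have hdet : (a : ℂ) * d - (M 0 1 : ℂ) * c = 1 := by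
    have h := M.det_coe
    rw [det_fin_two, hMc, hMd] at h
    exact_mod_cast h
  obtain ⟨C, hC⟩ := exists_tsum_tensorForm_inv (n := Fin n) hk (realGram_posDef hL b)
  refine ⟨((Complex.I * c) ^ n) ^ (-(k : ℤ)) * C, fun Z hZ => ?_⟩
  let A : Matrix (Fin n) (Fin n) ℂ := (-Complex.I) • (Z + ((d : ℂ) / c) • 1)
  have hAsymm : A.IsSymm := by
    have hZs : Zᵀ = Z := hZ.1
    simp only [A, IsSymm, transpose_smul, transpose_add, transpose_one, hZs]
  have hApos : (A.map Complex.re).PosDef := by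
    have : A.map Complex.re = Z.map Complex.im := by
      ext i j
      have h : (((d : ℂ) / c) * (1 : Matrix (Fin n) (Fin n) ℂ) i j).im = 0 := by
        by_cases hij : i = j
        · have : (d : ℂ) / c = ((d / c : ℝ) : ℂ) := by push_cast; rfl
          rw [hij, one_apply_eq, mul_one, this, Complex.ofReal_im]
        · simp [hij]
      simp only [A, map_apply, Matrix.smul_apply, Matrix.add_apply, smul_eq_mul, neg_mul, Complex.neg_re,
        Complex.I_mul_re, Complex.add_im, h, add_zero, neg_neg]
    rw [this]
    exact hZ.2
  obtain ⟨hA0, hsum, hsum', hinv⟩ := hC A hAsymm hApos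
  obtain ⟨hW, hZ'⟩ := smul_add_mul_inv_eq hc0 hdet (Z := Z) (A := A) rfl hA0
  rw [realGram_inv hL.nondegenerate hL.isSymm, ← hβ] at hsum' hinv
  rw [slash_diagEmbed, hMc, hMd]
  simp only [Int.cast_natCast]
  rw [hZ', hW, det_smul, Fintype.card_fin, mul_zpow]
  let vec (v : ι → V) (X : Fin n × ι → ℤ) (i : Fin n) : V := intComb v fun s => X (i, s)
  have htheta (Z' : Matrix (Fin n) (Fin n) ℂ) :
      theta B n L Z' = ∑' X : Fin n × ι → ℤ, thetaTerm B Z' (vec b X) := by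
    refine tsum_tuple_eq_tsum_intComb b hb.ge (F := thetaTerm B Z') fun x hx _ i => ?_
    rw [← hb]
    exact hx i
  let h (X : Fin n × ι → ℤ) : ℂ := expRat (∑ i, phase B a c d 0 (vec b X i))
  -- The term `a/c` gives the root of unity `h X`; the term in `A⁻¹` gives a Gaussian at `X / c`.
  have hterm (X : Fin n × ι → ℤ) :
      thetaTerm B ((a / c : ℂ) • 1 + (Complex.I / c ^ 2) • A⁻¹) (vec b X) =
        h X * Complex.exp (-Real.pi *
          tensorForm (realGram B b) A⁻¹ ((c : ℝ)⁻¹ • intVec X)) := by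
    rw [thetaTerm, mul_add, trace_add, trace_gram_smul_one, mul_smul_comm, trace_smul,
      trace_gram_mul hL.isSymm, tensorForm_smul, tensorForm_realGram]
    simp only [h, expRat]
    rw [← Complex.exp_add]
    congr 1
    have h1 : ∑ i, phase B a c d 0 (vec b X i) = a / (2 * c) * ∑ i, B (vec b X i) (vec b X i) := by
      rw [Finset.mul_sum]
      refine Finset.sum_congr rfl fun i _ => ?_
      simp only [phase, map_zero, LinearMap.zero_apply]
      ring
    rw [h1]
    push_cast
    simp only [vec, smul_eq_mul]
    field_simp
    linear_combination (∑ i, ∑ j, A⁻¹ i j * ((B (intComb b fun s => X (i, s))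
      (intComb b fun s => X (j, s)) : ℚ) : ℂ)) * Complex.I_sq
  have hper (r : Fin n × ι → ZMod c) (y : Fin n × ι → ℤ) :
      h (residueVec r y) = h fun q => (r q).cast := by
    refine expRat_eq_of_sub_mem ?_
    rw [← Finset.sum_sub_distrib]
    refine sum_mem fun i _ => ?_
    have : vec b (residueVec r y) i = vec b (fun q => (r q).cast) i + (c : ℤ) • vec b y i := by
      simp only [vec, ← intComb_smul, ← intComb_add]
      rfl
    rw [this]
    exact phase_add_smul_sub_mem hL (zero_mem _) (intComb_mem hb _) (intComb_mem hb _)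
  let ρ (r : Fin n × ι → ZMod c) : Fin n × ι → ℝ := (c : ℝ)⁻¹ • intVec fun q => (r q).cast
  have hscale (r : Fin n × ι → ZMod c) (y : Fin n × ι → ℤ) :
      (c : ℝ)⁻¹ • intVec (residueVec r y) = intVec y + ρ r := by
    have hc' : (c : ℝ) ≠ 0 := by exact_mod_cast NeZero.ne c
    ext q
    simp only [ρ, residueVec, Pi.smul_apply, Pi.add_apply, intVec_apply, smul_eq_mul]
    push_cast
    field_simp
    ring
  have hres (r : Fin n × ι → ZMod c) (y : Fin n × ι → ℤ) :
      thetaTerm B ((a / c : ℂ) • 1 + (Complex.I / c ^ 2) • A⁻¹) (vec b (residueVec r y)) =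
        h (fun q => (r q).cast) * Complex.exp (-Real.pi *
          tensorForm (realGram B b) A⁻¹ (intVec y + ρ r)) := by
    rw [hterm, hper, hscale]
  rw [htheta, tsum_eq_sum_tsum_residueVec (c := c)
    (fun r => by simp only [hres]; exact (hsum (ρ r)).mul_left _)]
  simp only [hres, tsum_mul_left, hinv]
  -- The residue sum is finite and the characters have modulus `1`, so the two sums may be
  -- interchanged.
  have hswap : ∑ r : Fin n × ι → ZMod c, h (fun q => (r q).cast) * (C * A.det ^ k *
      ∑' Ξ : Fin n × ι → ℤ, Complex.exp (-Real.pi * tensorForm (realGram B β) A (intVec Ξ)) *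
        Complex.exp (2 * Real.pi * Complex.I * ∑ q, (Ξ q : ℂ) * ρ r q)) =
      C * A.det ^ k * ∑' Ξ : Fin n × ι → ℤ, ∑ r : Fin n × ι → ZMod c, h (fun q => (r q).cast) *
        (Complex.exp (-Real.pi * tensorForm (realGram B β) A (intVec Ξ)) *
        Complex.exp (2 * Real.pi * Complex.I * ∑ q, (Ξ q : ℂ) * ρ r q)) := by
    rw [Summable.tsum_finsetSum, Finset.mul_sum]
    · refine Finset.sum_congr rfl fun r _ => ?_
      rw [tsum_mul_left]
      ring
    · intro r _
      refine Summable.mul_left _ (Summable.of_norm ?_)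
      refine hsum'.norm.congr fun Ξ => ?_
      have h1 : (2 * Real.pi * Complex.I * ∑ q, (Ξ q : ℂ) * ρ r q : ℂ) =
          ((2 * Real.pi * ∑ q, (Ξ q : ℝ) * ρ r q : ℝ) : ℂ) * Complex.I := by
        push_cast
        ring
      rw [norm_mul, h1, Complex.norm_exp_ofReal_mul_I, mul_one]
  rw [hswap]
  have hcoef (Ξ : Fin n × ι → ℤ) : ∑ r : Fin n × ι → ZMod c, h (fun q => (r q).cast) *
        (Complex.exp (-Real.pi * tensorForm (realGram B β) A (intVec Ξ)) *
        Complex.exp (2 * Real.pi * Complex.I * ∑ q, (Ξ q : ℂ) * ρ r q)) =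
      thetaTerm B Z (vec β Ξ) * ∏ i, gaussSum B b a c d (vec β Ξ i) := by
    -- Substituting `A = -i(Z + d/c)` recovers the theta term at `Z`, and `d/c` leaves the third
    -- part of the phase.
    have hE : Complex.exp (-Real.pi * tensorForm (realGram B β) A (intVec Ξ)) =
        thetaTerm B Z (vec β Ξ) *
          expRat (∑ i, d * B (vec β Ξ i) (vec β Ξ i) / (2 * c)) := by
      rw [tensorForm_realGram, ← trace_gram_mul hL.isSymm A (vec β Ξ)]
      simp only [A]
      rw [mul_smul_comm, trace_smul, mul_add, trace_add, trace_gram_smul_one, thetaTerm, expRat,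
        ← Complex.exp_add]
      congr 1
      have h1 : ∑ i, d * B (vec β Ξ i) (vec β Ξ i) / (2 * c) =
          d / (2 * c) * ∑ i, B (vec β Ξ i) (vec β Ξ i) := by
        rw [Finset.mul_sum]
        exact Finset.sum_congr rfl fun i _ => by ring
      rw [h1, smul_eq_mul]
      push_cast
      field_simp
    -- By duality of the bases, the coordinate pairing in the Poisson character is `B(ξ, r) / c`.
    have hpair (r : Fin n × ι → ZMod c) :
        Complex.exp (2 * Real.pi * Complex.I * ∑ q, (Ξ q : ℂ) * ρ r q) =
          expRat (∑ i, B (vec β Ξ i) (vec b (fun q => (r q).cast) i) / c) := by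
      have h1 (i : Fin n) : B (vec β Ξ i) (vec b (fun q => (r q).cast) i) =
          ∑ s, (Ξ (i, s) : ℚ) * ((r (i, s)).cast : ℤ) := by
        simp only [vec, bilin_intComb, hβ, LinearMap.BilinForm.apply_dualBasis_left, mul_ite,
          mul_one, mul_zero, Finset.sum_ite_eq', Finset.mem_univ, if_true]
      rw [expRat]
      congr 2
      simp only [h1, Fintype.sum_prod_type, ρ, Finset.sum_div, Pi.smul_apply, smul_eq_mul,
        intVec_apply]
      push_cast
      refine Finset.sum_congr rfl fun i _ => Finset.sum_congr rfl fun s _ => by ring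
    rw [← sum_prod_phase, Finset.mul_sum]
    refine Finset.sum_congr rfl fun r _ => ?_
    have h2 : ∑ i, phase B a c d (vec β Ξ i) (intComb b fun s => (r (i, s)).cast) =
        ∑ i, phase B a c d 0 (vec b (fun q => (r q).cast) i) +
          ∑ i, B (vec β Ξ i) (vec b (fun q => (r q).cast) i) / c +
          ∑ i, d * B (vec β Ξ i) (vec β Ξ i) / (2 * c) := by
      rw [← Finset.sum_add_distrib, ← Finset.sum_add_distrib]
      exact Finset.sum_congr rfl fun i _ => phase_eq_zero_add _ _ _ _ _
    rw [h2, expRat_add, expRat_add, hE, hpair]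
    simp only [h]
    ring
  simp only [hcoef]
  -- The factor from `det(icA) ^ (-k)` meets the `det A ^ k` of the inversion formula.
  have hk' : A.det ^ (-(k : ℤ)) * A.det ^ k = 1 := by
    rw [_root_.zpow_neg, zpow_natCast, inv_mul_cancel₀ (pow_ne_zero _ hA0)]
  linear_combination (((Complex.I * c) ^ n) ^ (-(k : ℤ)) * C *
    ∑' Ξ : Fin n × ι → ℤ, thetaTerm B Z (vec β Ξ) * ∏ i, gaussSum B b a c d (vec β Ξ i)) * hk'

end Main

end Kitaoka

theorem mainTheorem4 {V : Type*} [AddCommGroup V] [Module ℚ V]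
    (B : LinearMap.BilinForm ℚ V) (L : Submodule ℤ V) (k n N d : ℕ)
    (hL : Kitaoka.IsEvenPosDefLattice B L) (hrank : Module.finrank ℤ L = 2 * k)
    (hN : Kitaoka.IsLevel B L N) (hdN : d ∣ N) (hcop : Nat.Coprime d (N / d))
    (M : Matrix.SpecialLinearGroup (Fin 2) ℤ)
    (hc : M 1 0 = ((N / d : ℕ) : ℤ)) (hd : M 1 1 = (d : ℤ)) :
    (∃! L' : Submodule ℤ V, Kitaoka.IsPartialDual B L d L') ∧
      ∀ L' : Submodule ℤ V, Kitaoka.IsPartialDual B L d L' →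
        ∃ κ : ℂ, ∀ Z ∈ Kitaoka.siegelUpperHalfSpace n,
          Kitaoka.slash k (Kitaoka.diagEmbed n M) (Kitaoka.theta B n L) Z =
            κ * Kitaoka.theta B n L' Z := by
  open Kitaoka in
  have hNcd : N = N / d * d := (Nat.div_mul_cancel hdN).symm
  generalize N / d = c at hcop hc hNcd
  have hc0 : NeZero c := ⟨fun h => by
    have := hN.1.1
    simp [hNcd, h] at this⟩
  have hpd := isPartialDual_partialDual hL hN hNcd hcop
  refine ⟨⟨_, hpd, fun L' hL' => hL'.unique hpd⟩, fun L' hL' => ?_⟩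
  rw [hL'.unique hpd]
  have hdet : M 0 0 * d - M 0 1 * c = 1 := by
    have h := M.det_coe
    rwa [Matrix.det_fin_two, hc, hd] at h
  have := hL.isLattice
  obtain ⟨b, hb⟩ := exists_basis_span_eq L
  obtain ⟨C, hC⟩ := exists_theta_slash_eq_tsum_gaussSum (n := n) hL b hb (k := k)
    (by rw [Fintype.card_fin, hrank]) M hc hd
  have hdual : B.dualSubmodule L =
      Submodule.span ℤ (Set.range (B.dualBasis hL.nondegenerate b)) := by
    rw [← LinearMap.BilinForm.dualSubmodule_span_of_basis (R := ℤ) B hL.nondegenerate b, hb]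
  let F (Z : Matrix (Fin n) (Fin n) ℂ) (x : Fin n → V) : ℂ :=
    thetaTerm B Z x * ∏ i, gaussSum B b (M 0 0) c d (x i)
  refine ⟨C * gaussSum B b (M 0 0) c d 0 ^ n, fun Z hZ => ?_⟩
  rw [hC Z hZ, mul_assoc]
  congr 1
  -- One entry outside the partial dual annihilates the product of Gauss sums, so the sum over
  -- tuples from `L*` reduces to tuples from the partial dual.
  have h1 := tsum_tuple_eq_tsum_intComb (B.dualBasis hL.nondegenerate b)
    (M := partialDual B L d) (hdual ▸ inf_le_left) (F := F Z) fun x hx hne i => by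
      by_contra hi
      refine hne (mul_eq_zero_of_right _ (Finset.prod_eq_zero (Finset.mem_univ i) ?_))
      exact gaussSum_of_notMem hL hb hN hNcd hdet (hdual ▸ hx i) hi
  rw [← h1, theta, ← tsum_mul_left]
  refine tsum_congr fun x => ?_
  simp only [F, gaussSum_of_mem hL hb hN hNcd hdet (x _).2, Finset.prod_const, Finset.card_univ,
    Fintype.card_fin]
  exact mul_comm _ _
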